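/- There are a deterministic algorithm and a polynomial $p$ such that the following holds. Let $G$ be a finite simple graph on $n$ vertices, given by its adjacency matrix, in which the vertices of degree at least $5$ form a stable set (no two of them are adjacent), or in which every induced cycle of odd length (triangles included) contains a vertex whose degree in $G$ is at most $3$. Then the algorithm, run on $G$, halts after at most $p(n)$ steps and outputs a proper vertex coloring of $G$ that uses at most $$\left\lceil \frac{\Delta(G)+\omega(G)+1}{2} \right\rceil$$ colors, where $\Delta(G)$ is the maximum degree and $\omega(G)$ the clique number of $G$. Here an algorithm is a program for a random access machine on natural numbers whose elementary operations (constants, reading and writing registers and array cells, addition, truncated subtraction, tests for zero) cost one step each. -/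

import Mathlib

/-!
A deterministic random access machine, given by structured programs over natural-number registers
and arrays, with a step count. Arithmetic is restricted to addition and truncated subtraction, each
at unit cost (there is no multiplication), so after `t` steps all numbers have `O(t)` more bits than
those of the input, and polynomial time on this machine is polynomial time on Turing machines.
-/

namespace RAM

/-- A memory state: registers `reg r` and arrays `arr a`, all cells holding natural numbers.
A program mentions only finitely many registers and arrays. -/
structure State where
  reg : ℕ → ℕ
  arr : ℕ → ℕ → ℕ

/-- Expressions: constants, registers, array cells, sums and truncated differences. -/
inductive Expr : Type
  | const (c : ℕ)
  | var (r : ℕ)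
  | read (a : ℕ) (i : Expr)
  | plus (e₁ e₂ : Expr)
  | minus (e₁ e₂ : Expr)

/-- The value of an expression. -/
def Expr.eval (s : State) : Expr → ℕ
  | .const c => c
  | .var r => s.reg r
  | .read a i => s.arr a (i.eval s)
  | .plus e₁ e₂ => e₁.eval s + e₂.eval s
  | .minus e₁ e₂ => e₁.eval s - e₂.eval s

/-- The number of steps needed to evaluate an expression: one for each operation in it. -/
def Expr.cost : Expr → ℕ
  | .const _ => 1
  | .var _ => 1
  | .read _ i => i.cost + 1
  | .plus e₁ e₂ => e₁.cost + e₂.cost + 1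
  | .minus e₁ e₂ => e₁.cost + e₂.cost + 1

/-- Programs. -/
inductive Prog : Type
  /-- do nothing -/
  | skip
  /-- `reg r := e` -/
  | assign (r : ℕ) (e : Expr)
  /-- `arr a [i] := e` -/
  | store (a : ℕ) (i e : Expr)
  /-- `p; q` -/
  | seq (p q : Prog)
  /-- `if e ≠ 0 then p else q` -/
  | cond (e : Expr) (p q : Prog)
  /-- `while e ≠ 0 do p` -/
  | loop (e : Expr) (p : Prog)

/-- `Exec p s t s'`: started in state `s`, the program `p` halts after exactly `t` steps, in
state `s'`. -/
inductive Exec : Prog → State → ℕ → State → Prop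
  | skip (s : State) : Exec .skip s 1 s
  | assign (r : ℕ) (e : Expr) (s : State) :
      Exec (.assign r e) s (e.cost + 1)
        { s with reg := Function.update s.reg r (e.eval s) }
  | store (a : ℕ) (i e : Expr) (s : State) :
      Exec (.store a i e) s (i.cost + e.cost + 1)
        { s with arr := Function.update s.arr a
                          (Function.update (s.arr a) (i.eval s) (e.eval s)) }
  | seq {p q : Prog} {s s' s'' : State} {t t' : ℕ} :
      Exec p s t s' → Exec q s' t' s'' → Exec (.seq p q) s (t + t') s''
  | cond_true {e : Expr} {p q : Prog} {s s' : State} {t : ℕ} :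
      e.eval s ≠ 0 → Exec p s t s' → Exec (.cond e p q) s (e.cost + 1 + t) s'
  | cond_false {e : Expr} {p q : Prog} {s s' : State} {t : ℕ} :
      e.eval s = 0 → Exec q s t s' → Exec (.cond e p q) s (e.cost + 1 + t) s'
  | loop_stop {e : Expr} {p : Prog} {s : State} :
      e.eval s = 0 → Exec (.loop e p) s (e.cost + 1) s
  | loop_step {e : Expr} {p : Prog} {s s' s'' : State} {t t' : ℕ} :
      e.eval s ≠ 0 → Exec p s t s' → Exec (.loop e p) s' t' s'' →
      Exec (.loop e p) s (e.cost + 1 + t + t') s''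

/-- The machine is deterministic: running time and final state are determined by the program and
the initial state. -/
theorem Exec.deterministic {p : Prog} {s s₁ s₂ : State} {t₁ t₂ : ℕ}
    (h₁ : Exec p s t₁ s₁) (h₂ : Exec p s t₂ s₂) : t₁ = t₂ ∧ s₁ = s₂ := by
  induction h₁ generalizing t₂ s₂ with
  | skip | assign | store => cases h₂; exact ⟨rfl, rfl⟩
  | seq _ _ ih ih' =>
    cases h₂ with
    | seq h h' => obtain ⟨rfl, rfl⟩ := ih h; obtain ⟨rfl, rfl⟩ := ih' h'; exact ⟨rfl, rfl⟩
  | cond_true hc _ ih =>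
    cases h₂ with
    | cond_true _ h => obtain ⟨rfl, rfl⟩ := ih h; exact ⟨rfl, rfl⟩
    | cond_false h _ => exact absurd h hc
  | cond_false hc _ ih =>
    cases h₂ with
    | cond_true h _ => exact absurd hc h
    | cond_false _ h => obtain ⟨rfl, rfl⟩ := ih h; exact ⟨rfl, rfl⟩
  | loop_stop hc =>
    cases h₂ with
    | loop_stop _ => exact ⟨rfl, rfl⟩
    | loop_step h _ _ => exact absurd hc h
  | loop_step hc _ _ ih ih' =>
    cases h₂ with
    | loop_stop h => exact absurd h hc
    | loop_step _ h h' => obtain ⟨rfl, rfl⟩ := ih h; obtain ⟨rfl, rfl⟩ := ih' h'; exact ⟨rfl, rfl⟩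

open Classical in
/-- The initial state for a graph `G` on the vertices `0, …, n - 1`: register `0` holds `n`, array
`0` holds the adjacency matrix row by row (entry `(i, j)` in cell `i * n + j`), and everything else
is zero. -/
noncomputable def graphInput {n : ℕ} (G : SimpleGraph (Fin n)) : State where
  reg r := if r = 0 then n else 0
  arr a k := if a = 0 ∧ ∃ i j : Fin n, k = (i : ℕ) * n + (j : ℕ) ∧ G.Adj i j then 1 else 0

end RAM

/-- The vertices of degree at least `5` form a stable set. -/
def HighDegreeStable {n : ℕ} (G : SimpleGraph (Fin n)) [DecidableRel G.Adj] : Prop :=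
  G.IsIndepSet {v | 5 ≤ G.degree v}

/-- Every induced odd cycle (triangles included) contains a vertex of degree at most `3`. -/
def OddCyclesHaveLowDegree {n : ℕ} (G : SimpleGraph (Fin n)) [DecidableRel G.Adj] : Prop :=
  ∀ k : ℕ, 3 ≤ k → Odd k → ∀ f : SimpleGraph.cycleGraph k ↪g G, ∃ i, G.degree (f i) ≤ 3

/-- The coloring `C` uses at most `⌈(Δ(G) + ω(G) + 1) / 2⌉` colors. -/
def ObeysReed {n : ℕ} (G : SimpleGraph (Fin n)) [DecidableRel G.Adj] (C : G.Coloring ℕ) : Prop :=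
  (Finset.univ.image C).card ≤ ⌈((G.maxDegree : ℚ) + (G.cliqueNum : ℚ) + 1) / 2⌉₊

/-! Write `Δ` for the maximum degree and `ω` for the clique number. Since `k` is an integer, `k`
colors are few enough iff `2k ≤ Δ + ω + 2`. For constants `d` and `k`, color the vertices of degree
at least `d` first and then extend the coloring to the others with the colors `1, …, k`; one of six
pairs `(d, k)` always works (`exists_solvable`).

If two vertices of degree at least 5 are adjacent, then `Δ ≥ 5` and `ω ≥ 2`, so four colors are
allowed. Now the hypothesis on odd cycles holds, and since a graph that is not bipartite has an
induced odd cycle, the vertices of degree at least 4 induce a bipartite graph. They get two colors;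
the others have at most three neighbors and are colored greedily. If the vertices of degree at least
5 are stable, they get color 1. Greedy coloring then settles the graphs with a 4-clique (`k = 5`, or
`k = 4` if `Δ = 3`) and those with `Δ ≤ 1`. There remain graphs without 4-cliques, with `k = 4` if
`Δ ≥ 4` and `k = 3` if `Δ` is 2 or 3. The vertices still to be colored have at most `k` neighbors,
so a form of Brooks' theorem is needed that leaves the precolored vertices alone.

It is proved by Kempe exchanges (`Kempe.Config.freeable`), with three colors that occur only at
vertices of small degree. If few exchanges free no color at an uncolored vertex `v`, then each color
occurs exactly once at its neighbors, the neighbors of two of the three colors are joined by a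
two-colored path that is a whole component, and two such paths from one neighbor `x` share no other
vertex of the color of `x`. If two of these neighbors were not adjacent, one more exchange would
violate the last property. So the three neighbors and `v` form a 4-clique.

Three exchanges suffice, and an exchange is given by a vertex and a color, so exhaustive search is
polynomial. The algorithm neither tests the hypotheses nor computes `Δ` and `ω`: it tries all six
pairs with `k` never increasing and keeps the last success. It consists of bounded loops only, so a
polynomial time bound can be read off its text. -/

/-! ### Bounded-loop programs, their compilation and running time -/

namespace RAM

/-- Programs with bounded loops: `iter r none c` runs `c` with `reg r = 0, …, n - 1`, where `n` is
the content of register `0`, and `iter r (some m) c` runs it with `reg r = 0, …, m - 1`. -/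
inductive Cmd : Type
  | skip
  | assign (r : ℕ) (e : Expr)
  | store (a : ℕ) (i e : Expr)
  | seq (p q : Cmd)
  | cond (e : Expr) (p q : Cmd)
  | iter (r : ℕ) (b : Option ℕ) (p : Cmd)

/-- Write a register. -/
def State.set (s : State) (r v : ℕ) : State := { s with reg := Function.update s.reg r v }

/-- Write an array cell. -/
def State.put (s : State) (a i v : ℕ) : State :=
  { s with arr := Function.update s.arr a (Function.update (s.arr a) i v) }

@[simp] theorem State.set_reg (s : State) (r v q : ℕ) :
    (s.set r v).reg q = if q = r then v else s.reg q := by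
  simp [State.set, Function.update_apply]

@[simp] theorem State.set_arr (s : State) (r v : ℕ) : (s.set r v).arr = s.arr := rfl

@[simp] theorem State.put_reg (s : State) (a i v : ℕ) : (s.put a i v).reg = s.reg := rfl

@[simp] theorem State.put_arr (s : State) (a i v b j : ℕ) :
    (s.put a i v).arr b j = if b = a ∧ j = i then v else s.arr b j := by
  by_cases hb : b = a
  · subst hb
    by_cases hj : j = i <;> simp [State.put, hj]
  · simp [State.put, hb]

theorem State.put_arr_of_ne (s : State) {a b : ℕ} (i v : ℕ) (h : b ≠ a) :
    (s.put a i v).arr b = s.arr b := by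
  simp [State.put, h]

/-- The number of rounds of a bounded loop. -/
def rounds (s : State) : Option ℕ → ℕ
  | none => s.reg 0
  | some m => m

namespace Cmd

/-- The effect of a program on the memory. -/
def run : Cmd → State → State
  | skip, s => s
  | assign r e, s => s.set r (e.eval s)
  | store a i e, s => s.put a (i.eval s) (e.eval s)
  | seq p q, s => q.run (p.run s)
  | cond e p q, s => if e.eval s = 0 then q.run s else p.run s
  | iter r b p, s =>
      ((List.range (rounds s b)).foldl (fun t i => p.run (t.set r i)) s).set r (rounds s b)

/-- The registers that a program may change. -/
def writesReg : Cmd → ℕ → Bool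
  | skip, _ => false
  | assign r _, q => q == r
  | store _ _ _, _ => false
  | seq c d, q => c.writesReg q || d.writesReg q
  | cond _ c d, q => c.writesReg q || d.writesReg q
  | iter r _ c, q => q == r || c.writesReg q

/-- The arrays that a program may change. -/
def writesArr : Cmd → ℕ → Bool
  | skip, _ => false
  | assign _ _, _ => false
  | store a _ _, b => b == a
  | seq c d, b => c.writesArr b || d.writesArr b
  | cond _ c d, b => c.writesArr b || d.writesArr b
  | iter _ _ c, b => c.writesArr b

/-- No program changes register `0`, and no loop body changes its loop register. -/
def wf : Cmd → Bool
  | skip => true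
  | assign r _ => !(r == 0)
  | store _ _ _ => true
  | seq c d => c.wf && d.wf
  | cond _ c d => c.wf && d.wf
  | iter r _ c => !(r == 0) && !(c.writesReg r) && c.wf

theorem run_reg {c : Cmd} {q : ℕ} (h : c.writesReg q = false) (s : State) :
    (c.run s).reg q = s.reg q := by
  induction c generalizing s with
  | skip => rfl
  | assign r e =>
    have : q ≠ r := by simpa [writesReg] using h
    simp [run, this]
  | store a i e => rfl
  | seq c d ihc ihd =>
    simp only [writesReg, Bool.or_eq_false_iff] at h
    rw [run, ihd h.2, ihc h.1]
  | cond e c d ihc ihd =>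
    simp only [writesReg, Bool.or_eq_false_iff] at h
    rw [run]; split_ifs
    · exact ihd h.2 s
    · exact ihc h.1 s
  | iter r b c ih =>
    simp only [writesReg, Bool.or_eq_false_iff, beq_eq_false_iff_ne] at h
    rw [run, State.set_reg, if_neg h.1]
    generalize List.range (rounds s b) = l
    induction l generalizing s with
    | nil => rfl
    | cons i l ihl => rw [List.foldl_cons, ihl, ih h.2, State.set_reg, if_neg h.1]

theorem run_arr {c : Cmd} {a : ℕ} (h : c.writesArr a = false) (s : State) :
    (c.run s).arr a = s.arr a := by
  induction c generalizing s with
  | skip => rfl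
  | assign r e => rfl
  | store b i e =>
    have : a ≠ b := by simpa [writesArr] using h
    exact State.put_arr_of_ne _ _ _ this
  | seq c d ihc ihd =>
    simp only [writesArr, Bool.or_eq_false_iff] at h
    rw [run, ihd h.2, ihc h.1]
  | cond e c d ihc ihd =>
    simp only [writesArr, Bool.or_eq_false_iff] at h
    rw [run]; split_ifs
    · exact ihd h.2 s
    · exact ihc h.1 s
  | iter r b c ih =>
    simp only [writesArr] at h
    rw [run, State.set_arr]
    generalize List.range (rounds s b) = l
    induction l generalizing s with
    | nil => rfl
    | cons i l ihl => rw [List.foldl_cons, ihl, ih h, State.set_arr]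

/-- The invariant rule for bounded loops. -/
theorem run_iter {r : ℕ} {b : Option ℕ} {c : Cmd} (I : ℕ → State → Prop) (s : State) (h0 : I 0 s)
    (hstep : ∀ i s', i < rounds s b →
      (∀ q, q ≠ r → c.writesReg q = false → s'.reg q = s.reg q) →
      (∀ a, c.writesArr a = false → s'.arr a = s.arr a) →
      I i s' → I (i + 1) (c.run (s'.set r i))) :
    ∃ s', I (rounds s b) s' ∧ (iter r b c).run s = s'.set r (rounds s b) ∧
      (∀ q, q ≠ r → c.writesReg q = false → s'.reg q = s.reg q) ∧
      (∀ a, c.writesArr a = false → s'.arr a = s.arr a) := by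
  have main : ∀ N, N ≤ rounds s b →
      I N ((List.range N).foldl (fun t i => c.run (t.set r i)) s) ∧
      (∀ q, q ≠ r → c.writesReg q = false →
        ((List.range N).foldl (fun t i => c.run (t.set r i)) s).reg q = s.reg q) ∧
      (∀ a, c.writesArr a = false →
        ((List.range N).foldl (fun t i => c.run (t.set r i)) s).arr a = s.arr a) := by
    intro N
    induction N with
    | zero => exact fun _ => ⟨h0, fun _ _ _ => rfl, fun _ _ => rfl⟩
    | succ N ih =>
      intro hN
      obtain ⟨h1, h2, h3⟩ := ih (by omega)
      rw [List.range_succ, List.foldl_append, List.foldl_cons, List.foldl_nil]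
      refine ⟨hstep N _ hN h2 h3 h1, ?_, ?_⟩
      · intro q hq hw
        rw [run_reg hw, State.set_reg, if_neg hq, h2 q hq hw]
      · intro a ha
        rw [run_arr ha, State.set_arr, h3 a ha]
  obtain ⟨h1, h2, h3⟩ := main _ le_rfl
  exact ⟨_, h1, rfl, h2, h3⟩

/-- The bound of a loop, as an expression. -/
def boundExpr : Option ℕ → Expr
  | none => .var 0
  | some m => .const m

/-- Translation into programs of the machine. -/
def compile : Cmd → Prog
  | skip => .skip
  | assign r e => .assign r e
  | store a i e => .store a i e
  | seq p q => .seq p.compile q.compile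
  | cond e p q => .cond e p.compile q.compile
  | iter r b p => .seq (.assign r (.const 0))
      (.loop (.minus (boundExpr b) (.var r))
        (.seq p.compile (.assign r (.plus (.var r) (.const 1)))))

/-- The bound of a loop, as a polynomial in the content of register `0`. -/
noncomputable def boundPoly : Option ℕ → Polynomial ℕ
  | none => .X
  | some m => .C m

/-- A bound for the running time, as a polynomial in the content of register `0`. -/
noncomputable def time : Cmd → Polynomial ℕ
  | skip => .C 1
  | assign _ e => .C (e.cost + 1)
  | store _ i e => .C (i.cost + e.cost + 1)
  | seq p q => p.time + q.time
  | cond e p q => .C (e.cost + 1) + p.time + q.time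
  -- Initialization costs 2 and the final test 4; each round adds 4 for the test and 4 for the
  -- increment.
  | iter _ b p => .C 6 + boundPoly b * (p.time + .C 8)

/-- Register `0` keeps the value `n` throughout, so time bounds for all parts of a program can be
evaluated at its initial content. -/
theorem wf_writesReg_zero {c : Cmd} (h : c.wf = true) : c.writesReg 0 = false := by
  induction c with
  | skip | store => rfl
  | assign r e =>
    have : r ≠ 0 := by simpa [wf] using h
    simpa [writesReg] using this.symm
  | seq c d ihc ihd | cond e c d ihc ihd =>
    simp only [wf, Bool.and_eq_true] at h
    simp [writesReg, ihc h.1, ihd h.2]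
  | iter r b c ih =>
    simp only [wf, Bool.and_eq_true, Bool.not_eq_true', beq_eq_false_iff_ne] at h
    simpa [writesReg, ih h.2] using h.1.1.symm

/-- Compiled programs compute the effect of the source within its time bound. -/
theorem exec_compile {c : Cmd} (h : c.wf = true) (s : State) :
    ∃ t, t ≤ c.time.eval (s.reg 0) ∧ Exec c.compile s t (c.run s) := by
  induction c generalizing s with
  | skip => exact ⟨1, by simp [time], .skip s⟩
  | assign r e => exact ⟨_, by simp [time], .assign r e s⟩
  | store a i e => exact ⟨_, by simp [time], .store a i e s⟩
  | seq c d ihc ihd =>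
    simp only [wf, Bool.and_eq_true] at h
    obtain ⟨t, ht, hc⟩ := ihc h.1 s
    obtain ⟨t', ht', hd⟩ := ihd h.2 (c.run s)
    rw [run_reg (wf_writesReg_zero h.1)] at ht'
    exact ⟨t + t', by simpa [time] using add_le_add ht ht', .seq hc hd⟩
  | cond e c d ihc ihd =>
    simp only [wf, Bool.and_eq_true] at h
    rw [run]
    split_ifs with he
    · obtain ⟨t, ht, hd⟩ := ihd h.2 s
      exact ⟨_, by simp only [time, Polynomial.eval_add, Polynomial.eval_C]; omega,
        .cond_false he hd⟩
    · obtain ⟨t, ht, hc⟩ := ihc h.1 s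
      exact ⟨_, by simp only [time, Polynomial.eval_add, Polynomial.eval_C]; omega,
        .cond_true he hc⟩
  | iter r b c ih =>
    simp only [wf, Bool.and_eq_true, Bool.not_eq_true', beq_eq_false_iff_ne] at h
    obtain ⟨⟨hr, hw⟩, hc⟩ := h
    have hbcost : (boundExpr b).cost = 1 := by cases b <;> rfl
    have hbeval : ∀ s' : State, s'.reg 0 = s.reg 0 → (boundExpr b).eval s' = rounds s b := by
      intro s' hs'
      cases b with
      | none => exact hs'
      | some m => rfl
    have hbpoly : (boundPoly b).eval (s.reg 0) = rounds s b := by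
      cases b <;> simp [boundPoly, rounds]
    set N := rounds s b with hN
    -- Induction on the number `m` of rounds left. The compiled loop increments the register after
    -- the body, whereas `run` sets it before the body; the two agree if the loop is entered in the
    -- state `s'.set r i`.
    have loop : ∀ m i, i + m = N → ∀ s' : State, s'.reg 0 = s.reg 0 →
        ∃ t, t ≤ 4 + m * (c.time.eval (s.reg 0) + 8) ∧
          Exec (.loop (.minus (boundExpr b) (.var r))
            (.seq c.compile (.assign r (.plus (.var r) (.const 1))))) (s'.set r i) t
            (((List.range' i m).foldl (fun t i => c.run (t.set r i)) s').set r N) := by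
      intro m
      induction m with
      | zero =>
        intro i hi s' hs'
        obtain rfl : i = N := by omega
        refine ⟨_, ?_, Exec.loop_stop ?_⟩
        · simp [Expr.cost, hbcost]
        · simp only [Expr.eval]
          rw [hbeval _ (by simp [hr.symm, hs'])]
          simp
      | succ m ihm =>
        intro i hi s' hs'
        obtain ⟨t₁, ht₁, h₁⟩ := ih hc (s'.set r i)
        rw [State.set_reg, if_neg hr.symm, hs'] at ht₁
        have hreg : (c.run (s'.set r i)).reg r = i := by simp [run_reg hw]
        have hz : (c.run (s'.set r i)).reg 0 = s.reg 0 := by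
          rw [run_reg (wf_writesReg_zero hc), State.set_reg, if_neg hr.symm, hs']
        obtain ⟨t₂, ht₂, h₂⟩ := ihm (i + 1) (by omega) (c.run (s'.set r i)) hz
        have h₃ := Exec.assign r (.plus (.var r) (.const 1)) (c.run (s'.set r i))
        simp only [Expr.eval, hreg] at h₃
        refine ⟨_, ?_, Exec.loop_step ?_ (.seq h₁ h₃) h₂⟩
        · simp only [Expr.cost, hbcost]
          rw [Nat.succ_mul]
          omega
        · simp only [Expr.eval]
          rw [hbeval _ (by simp [hr.symm, hs'])]
          simp
          omega
    obtain ⟨t, ht, he⟩ := loop N 0 (by omega) s rfl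
    refine ⟨1 + 1 + t, ?_, Exec.seq (Exec.assign r (.const 0) s) ?_⟩
    · simp only [time, Polynomial.eval_add, Polynomial.eval_mul, Polynomial.eval_C, hbpoly]
      omega
    · rw [run, ← hN, List.range_eq_range']
      exact he

end Cmd

end RAM

/-! ### A criterion for a component to be a path -/

namespace SimpleGraph

theorem Reachable.of_closed {V : Type*} {D : SimpleGraph V} {x y : V} (P : V → Prop) (hx : P x)
    (hP : ∀ a b, P a → D.Adj a b → P b) (h : D.Reachable x y) : P y := by
  rw [reachable_iff_reflTransGen] at h
  induction h with
  | refl => exact hx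
  | tail _ hab ih => exact hP _ _ ih hab

/-- The graph without the edges at a vertex. -/
def avoid {V : Type*} (D : SimpleGraph V) (u : V) : SimpleGraph V where
  Adj p q := D.Adj p q ∧ p ≠ u ∧ q ≠ u
  symm := ⟨fun _ _ h => ⟨h.1.symm, h.2.2, h.2.1⟩⟩
  loopless := ⟨fun _ h => h.1.ne rfl⟩

/-- If `x` and `y` are joined and have at most one neighbor each, and no vertex with three
neighbors separates them, then the component of `x` and `y` is a path between them. -/
theorem component_is_path {V : Type*} {D : SimpleGraph V} {x y : V} (hne : x ≠ y)
    (hx : ∀ p q, D.Adj x p → D.Adj x q → p = q) (hy : ∀ p q, D.Adj y p → D.Adj y q → p = q)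
    (h3 : ∀ u p q r, u ≠ x → u ≠ y → D.Adj u p → D.Adj u q → D.Adj u r → p ≠ q → q ≠ r → p ≠ r →
      (D.avoid u).Reachable x y)
    (hxy : D.Reachable x y) {w : V} (hw : D.Reachable x w) (hwx : w ≠ x) (hwy : w ≠ y) :
    (∃ p q, p ≠ q ∧ D.Adj w p ∧ D.Adj w q) ∧ ¬ (D.avoid w).Reachable x y := by
  classical
  obtain ⟨P, hP⟩ := hxy.exists_isPath
  set p := P.getVert with hp
  set m := P.length with hm
  have inj : ∀ s t, s ≤ m → t ≤ m → p s = p t → s = t := fun s t hs ht h =>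
    hP.getVert_injOn hs ht h
  have adj : ∀ s, s < m → D.Adj (p s) (p (s + 1)) := fun s hs => P.adj_getVert_succ hs
  have p0 : p 0 = x := P.getVert_zero
  have pm : p m = y := P.getVert_length
  -- If the vertices before position `s` have no neighbors but those along the path, then they are a
  -- closed set once `p s` is removed, and `y` is not among them.
  have cut : ∀ s, 0 < s → s ≤ m →
      (∀ s' < s, ∀ q, D.Adj (p s') q → q = p (s' + 1) ∨ 0 < s' ∧ q = p (s' - 1)) →
      ¬ (D.avoid (p s)).Reachable x y := by
    intro s hs hsm hN hr
    obtain ⟨s', hs', h⟩ : ∃ s' < s, y = p s' := by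
      refine Reachable.of_closed (fun z => ∃ s' < s, z = p s') ⟨0, hs, p0.symm⟩ ?_ hr
      rintro a b ⟨s', hs', rfl⟩ hab
      rcases hN s' hs' b hab.1 with rfl | ⟨h0, rfl⟩
      · refine ⟨s' + 1, lt_of_le_of_ne hs' ?_, rfl⟩
        rintro rfl
        exact hab.2.2 rfl
      · exact ⟨s' - 1, by omega, rfl⟩
    rw [← pm] at h
    have := inj _ _ le_rfl (by omega) h
    omega
  have nbr : ∀ s, s < m → ∀ q, D.Adj (p s) q → q = p (s + 1) ∨ 0 < s ∧ q = p (s - 1) := by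
    intro s
    induction s using Nat.strong_induction_on with
    | _ s ih =>
      intro hs q hq
      rcases Nat.eq_zero_or_pos s with rfl | h0
      · left
        have := adj 0 hs
        rw [p0] at this hq
        exact hx _ _ hq this
      -- A neighbor off the path would be a third one. By `h3` the vertex `p s` then does not
      -- separate `x` from `y`, but by `cut` and the induction hypothesis it does.
      · by_contra hcon
        push Not at hcon
        refine cut s h0 hs.le (fun s' hs' => ih s' hs' (by omega)) ?_
        have a1 := adj (s - 1) (by omega)
        rw [Nat.sub_add_cancel h0] at a1
        refine h3 (p s) q (p (s + 1)) (p (s - 1)) ?_ ?_ hq (adj s hs) a1.symm hcon.1 ?_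
          (hcon.2 h0)
        · rw [← p0]; intro h; have := inj _ _ hs.le (by omega) h; omega
        · rw [← pm]; intro h; have := inj _ _ hs.le (by omega) h; omega
        · intro h; have := inj _ _ hs (by omega) h; omega
  -- The path is closed under adjacency, at its end because of `hy`, so it is the whole component.
  obtain ⟨s, hsm, rfl⟩ : ∃ s ≤ m, w = p s := by
    refine Reachable.of_closed (fun z => ∃ s ≤ m, z = p s) ⟨0, by omega, p0.symm⟩ ?_ hw
    rintro a b ⟨s, hs, rfl⟩ hab
    rcases hs.lt_or_eq with hlt | rfl
    · rcases nbr s hlt b hab with rfl | ⟨_, rfl⟩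
      · exact ⟨s + 1, hlt, rfl⟩
      · exact ⟨s - 1, by omega, rfl⟩
    · have h0 : 0 < m := Nat.pos_of_ne_zero fun h0 => hne (by rw [← p0, ← pm, h0])
      have a1 := adj (m - 1) (by omega)
      rw [Nat.sub_add_cancel h0, pm] at a1
      rw [pm] at hab
      exact ⟨m - 1, by omega, hy _ _ hab a1.symm⟩
  have h0 : 0 < s := Nat.pos_of_ne_zero fun h => hwx (by rw [h, p0])
  have hlt : s < m := lt_of_le_of_ne hsm fun h => hwy (by rw [h, pm])
  refine ⟨⟨p (s + 1), p (s - 1), ?_, adj s hlt, ?_⟩, cut s h0 hsm fun s' hs' => nbr s' (by omega)⟩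
  · intro h; have := inj _ _ hlt (by omega) h; omega
  · have a1 := adj (s - 1) (by omega)
    rw [Nat.sub_add_cancel h0] at a1
    exact a1.symm

end SimpleGraph

/-! ### Kempe exchanges on partial colorings -/

namespace Kempe

variable {n : ℕ} (G : SimpleGraph (Fin n))

/-- No two adjacent vertices have the same color; color `0` means uncolored. -/
def PartialProper (c : Fin n → ℕ) : Prop :=
  ∀ x y, G.Adj x y → c x ≠ 0 → c x ≠ c y

/-- The subgraph on the vertices of the colors `a` and `b`. -/
def chain (c : Fin n → ℕ) (a b : ℕ) : SimpleGraph (Fin n) where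
  Adj x y := G.Adj x y ∧ (c x = a ∨ c x = b) ∧ (c y = a ∨ c y = b)
  symm := ⟨fun _ _ h => ⟨h.1.symm, h.2.2, h.2.1⟩⟩
  loopless := ⟨fun _ h => h.1.ne rfl⟩

theorem chain_comm (c : Fin n → ℕ) (a b : ℕ) : chain G c a b = chain G c b a := by
  ext x y; simp only [chain]; tauto

variable {G} in
theorem chain_color {c : Fin n → ℕ} {a b : ℕ} {u x : Fin n} (hu : c u = a ∨ c u = b)
    (h : (chain G c a b).Reachable u x) : c x = a ∨ c x = b := by
  refine h.of_closed (fun x => c x = a ∨ c x = b) hu ?_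
  exact fun _ _ _ hab => hab.2.2

variable [DecidableRel G.Adj]

open Classical in
/-- Exchange the colors `c u` and `b` on the component of `u`, unless `u` is uncolored or the
component has a vertex of degree at least `d`. -/
noncomputable def swap (d : ℕ) (c : Fin n → ℕ) (u : Fin n) (b : ℕ) (x : Fin n) : ℕ :=
  if c u ≠ 0 ∧ (∀ y, (chain G c (c u) b).Reachable u y → G.degree y < d) ∧
    (chain G c (c u) b).Reachable u x then c u + b - c x else c x

/-- Some color from `1` to `k` does not occur at the neighbors of `v`. -/
def HasFree (k : ℕ) (v : Fin n) (c : Fin n → ℕ) : Prop :=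
  ∃ f, 1 ≤ f ∧ f ≤ k ∧ ∀ y, G.Adj v y → c y ≠ f

/-- At most `m` exchanges make a color from `1` to `k` free at `v`. -/
def Freeable (k d : ℕ) (v : Fin n) : ℕ → (Fin n → ℕ) → Prop
  | 0, c => HasFree G k v c
  | m + 1, c => HasFree G k v c ∨
      ∃ u b, 1 ≤ b ∧ b ≤ k ∧ Freeable k d v m (swap G d c u b)

variable {G}

theorem Freeable.of_hasFree {k d : ℕ} {v : Fin n} {m : ℕ} {c : Fin n → ℕ}
    (h : HasFree G k v c) : Freeable G k d v m c := by
  cases m with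
  | zero => exact h
  | succ m => exact .inl h

theorem Freeable.succ {k d : ℕ} {v : Fin n} {m : ℕ} {c : Fin n → ℕ}
    (h : Freeable G k d v m c) : Freeable G k d v (m + 1) c := by
  induction m generalizing c with
  | zero => exact .inl h
  | succ m ih =>
    rcases h with h | ⟨u, b, h1, h2, h⟩
    · exact .inl h
    · exact .inr ⟨u, b, h1, h2, ih h⟩

section swap

variable {d b : ℕ} {c : Fin n → ℕ} {u : Fin n}

theorem swap_apply_of_not_reachable {x : Fin n} (h : ¬ (chain G c (c u) b).Reachable u x) :
    swap G d c u b x = c x := by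
  rw [swap, if_neg (fun H => h H.2.2)]

theorem swap_apply_of_reachable {x : Fin n} (hu : c u ≠ 0)
    (hd : ∀ y, (c y = c u ∨ c y = b) → G.degree y < d) (h : (chain G c (c u) b).Reachable u x) :
    swap G d c u b x = c u + b - c x := by
  rw [swap, if_pos ⟨hu, fun y hy => hd y (chain_color (.inl rfl) hy), h⟩]

theorem swap_cases (d : ℕ) (c : Fin n → ℕ) (u : Fin n) (b : ℕ) :
    swap G d c u b = c ∨ (c u ≠ 0 ∧
      (∀ y, (chain G c (c u) b).Reachable u y → G.degree y < d) ∧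
      ∀ x, ((chain G c (c u) b).Reachable u x → swap G d c u b x = c u + b - c x) ∧
        (¬ (chain G c (c u) b).Reachable u x → swap G d c u b x = c x)) := by
  by_cases h : c u ≠ 0 ∧ (∀ y, (chain G c (c u) b).Reachable u y → G.degree y < d)
  · right
    refine ⟨h.1, h.2, fun x => ⟨fun hx => ?_, swap_apply_of_not_reachable⟩⟩
    rw [swap, if_pos ⟨h.1, h.2, hx⟩]
  · left
    funext x
    rw [swap, if_neg (fun H => h ⟨H.1, H.2.1⟩)]

theorem swap_eq_zero (hb : b ≠ 0) (x : Fin n) : swap G d c u b x = 0 ↔ c x = 0 := by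
  rcases swap_cases (G := G) d c u b with h | ⟨h0, _, h⟩
  · rw [h]
  · by_cases hx : (chain G c (c u) b).Reachable u x
    · rw [(h x).1 hx]
      have := chain_color (.inl rfl) hx
      omega
    · rw [(h x).2 hx]

/-- An exchange that would touch a vertex of degree at least `d` is refused. This guard keeps the
precoloring fixed during all searches. -/
theorem swap_of_le_degree {x : Fin n} (hx : d ≤ G.degree x) : swap G d c u b x = c x := by
  rcases swap_cases (G := G) d c u b with h | ⟨_, hd, h⟩
  · rw [h]
  · exact (h x).2 fun hr => absurd (hd x hr) (by omega)

theorem swap_le {k : ℕ} (hb : b ≤ k) (hc : ∀ x, c x ≤ k) (x : Fin n) : swap G d c u b x ≤ k := by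
  rcases swap_cases (G := G) d c u b with h | ⟨_, _, h⟩
  · rw [h]; exact hc x
  · by_cases hx : (chain G c (c u) b).Reachable u x
    · rw [(h x).1 hx]
      have h1 := chain_color (.inl rfl) hx
      have h2 := hc u
      omega
    · rw [(h x).2 hx]; exact hc x

/-- A component contains, with a vertex, all its neighbors of the two colors. So an edge with both
ends in these colors has both or neither of them exchanged, and other edges cannot become
monochromatic. -/
theorem PartialProper.swap (hb : b ≠ 0) (hc : PartialProper G c) : PartialProper G (swap G d c u b) := by
  rcases swap_cases (G := G) d c u b with h | ⟨_, _, h⟩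
  · rw [h]; exact hc
  · intro x y hxy
    have hs : ∀ x y, G.Adj x y → (chain G c (c u) b).Reachable u x →
        (c y = c u ∨ c y = b) → (chain G c (c u) b).Reachable u y := by
      intro x y hxy hx hy
      have ha : (chain G c (c u) b).Adj x y := ⟨hxy, chain_color (.inl rfl) hx, hy⟩
      exact hx.trans ha.reachable
    have h1 : c x = 0 ∨ c x ≠ c y := or_iff_not_imp_left.2 (hc x y hxy)
    have h2 : c y = 0 ∨ c y ≠ c x := or_iff_not_imp_left.2 (hc y x hxy.symm)
    intro h0
    by_cases hx : (chain G c (c u) b).Reachable u x <;>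
      by_cases hy : (chain G c (c u) b).Reachable u y
    · rw [(h x).1 hx] at h0 ⊢
      rw [(h y).1 hy]
      have h3 := chain_color (.inl rfl) hx
      have h4 := chain_color (.inl rfl) hy
      omega
    · rw [(h x).1 hx] at h0 ⊢
      rw [(h y).2 hy]
      have h3 := chain_color (.inl rfl) hx
      have h4 := mt (hs x y hxy hx) hy
      omega
    · rw [(h x).2 hx] at h0 ⊢
      rw [(h y).1 hy]
      have h3 := chain_color (.inl rfl) hy
      have h4 := mt (hs y x hxy.symm hy) hx
      omega
    · rw [(h x).2 hx] at h0 ⊢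
      rw [(h y).2 hy]
      omega

/-- Giving a vertex a color that is free at it is an exchange of colors. -/
theorem swap_eq_update {z : ℕ} (hc : PartialProper G c) (hu : c u ≠ 0) (hd : G.degree u < d)
    (hz : ∀ y, G.Adj u y → c y ≠ z) : swap G d c u z = Function.update c u z := by
  have hr : ∀ y, (chain G c (c u) z).Reachable u y → y = u := by
    intro y hy
    refine hy.of_closed (fun y => y = u) rfl ?_
    rintro a b rfl hab
    rcases hab.2.2 with h | h
    · exact absurd h.symm (hc _ _ hab.1 hu)
    · exact absurd h (hz b hab.1)
  funext x
  by_cases hx : x = u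
  · subst hx
    rw [Kempe.swap, if_pos ⟨hu, fun y hy => by rwa [hr y hy], .refl _⟩]
    simp
  · rw [swap_apply_of_not_reachable (fun h => hx (hr x h)), Function.update_of_ne hx]

end swap

/-- A vertex with at most `k` neighbors, two of which do not contribute a color of their own, can
get another color. -/
theorem exists_free {k : ℕ} {c : Fin n → ℕ} {u p q : Fin n} {a : ℕ} (ha : 1 ≤ a) (hak : a ≤ k)
    (hk : G.degree u ≤ k) (hup : G.Adj u p) (huq : G.Adj u q) (hpq : p ≠ q)
    (hp : c p = 0 ∨ ∃ r, G.Adj u r ∧ r ≠ p ∧ r ≠ q ∧ c r = c p)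
    (hq : c q = 0 ∨ ∃ r, G.Adj u r ∧ r ≠ p ∧ r ≠ q ∧ c r = c q) :
    ∃ z, 1 ≤ z ∧ z ≤ k ∧ z ≠ a ∧ ∀ y, G.Adj u y → c y ≠ z := by
  classical
  set S := (G.neighborFinset u).erase p |>.erase q with hS
  have hcard : S.card + 2 ≤ k := by
    have h1 : p ∈ G.neighborFinset u := by simpa
    have h2 : q ∈ (G.neighborFinset u).erase p := by simp [hpq.symm, huq]
    have h3 := Finset.card_erase_add_one h1
    have h4 := Finset.card_erase_add_one h2
    rw [← hS] at h4
    rw [G.card_neighborFinset_eq_degree] at h3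
    omega
  -- Without `p` and `q` there are at most `k - 2` neighbors, but `k - 1` colors other than `a`.
  have hlt : (S.image c).card < ((Finset.Icc 1 k).erase a).card := by
    rw [Finset.card_erase_of_mem (by simp [ha, hak]), Nat.card_Icc]
    have := Finset.card_image_le (s := S) (f := c)
    omega
  obtain ⟨z, hz, hzS⟩ := Finset.exists_mem_notMem_of_card_lt_card hlt
  simp only [Finset.mem_erase, Finset.mem_Icc] at hz
  refine ⟨z, hz.2.1, hz.2.2, hz.1, fun y hy hyz => hzS ?_⟩
  have key : ∀ r, G.Adj u r → r ≠ p → r ≠ q → c r = z → z ∈ S.image c := fun r h1 h2 h3 h4 =>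
    Finset.mem_image.2 ⟨r, by simp [S, h1, h2, h3], h4⟩
  by_cases h1 : y = p
  · subst h1
    rcases hp with h | ⟨r, h1, h2, h3, h4⟩
    · omega
    · exact key r h1 h2 h3 (h4.trans hyz)
  · by_cases h2 : y = q
    · subst h2
      rcases hq with h | ⟨r, h1, h2, h3, h4⟩
      · omega
      · exact key r h1 h2 h3 (h4.trans hyz)
    · exact key y hy h1 h2 hyz

/-- If no color from `1` to `k` is free at a vertex of degree at most `k`, then the colors of its
neighbors are distinct. -/
theorem eq_of_not_hasFree {k : ℕ} {c : Fin n → ℕ} {v x y : Fin n} (h : ¬ HasFree G k v c)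
    (hk : G.degree v ≤ k) (hx : G.Adj v x) (hy : G.Adj v y) (hxy : c x = c y) : x = y := by
  classical
  -- All `k` colors occur at no more than `k` neighbors, which forces the coloring to be injective
  -- on them.
  have hsub : Finset.Icc 1 k ⊆ (G.neighborFinset v).image c := by
    intro f hf
    rw [Finset.mem_Icc] at hf
    by_contra hcon
    exact h ⟨f, hf.1, hf.2, fun y hy hyf => hcon (Finset.mem_image.2 ⟨y, by simpa, hyf⟩)⟩
  have h1 := Finset.card_le_card hsub
  rw [Nat.card_Icc, Nat.add_sub_cancel] at h1
  have h2 := Finset.card_image_le (s := G.neighborFinset v) (f := c)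
  have h3 := G.card_neighborFinset_eq_degree v
  exact Finset.card_image_iff.1 (by omega : ((G.neighborFinset v).image c).card = _)
    (by simpa) (by simpa) hxy

/-! ### Brooks' theorem by Kempe exchanges -/

variable (G) in
/-- A partial coloring with `v` uncolored in which the vertices of three of the colors have small
degree. -/
structure Config (k d : ℕ) (v : Fin n) (i j l : ℕ) (c : Fin n → ℕ) : Prop where
  proper : PartialProper G c
  uncolored : c v = 0
  degree_le : G.degree v ≤ k
  one_le : 1 ≤ i ∧ 1 ≤ j ∧ 1 ≤ l
  le : i ≤ k ∧ j ≤ k ∧ l ≤ k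
  ne : i ≠ j ∧ i ≠ l ∧ j ≠ l
  small : ∀ x, c x = i ∨ c x = j ∨ c x = l → G.degree x ≤ k ∧ G.degree x < d

namespace Config

variable {k d : ℕ} {v : Fin n} {i j l : ℕ} {c : Fin n → ℕ}

/-- The three colors play the same role. With this and `comm₂₃`, facts stated for `i` and `j` apply
to any two of them in any order. -/
theorem comm₁₂ (h : Config G k d v i j l c) : Config G k d v j i l c where
  proper := h.proper
  uncolored := h.uncolored
  degree_le := h.degree_le
  one_le := ⟨h.one_le.2.1, h.one_le.1, h.one_le.2.2⟩
  le := ⟨h.le.2.1, h.le.1, h.le.2.2⟩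
  ne := ⟨h.ne.1.symm, h.ne.2.2, h.ne.2.1⟩
  small x hx := h.small x (by tauto)

theorem comm₂₃ (h : Config G k d v i j l c) : Config G k d v i l j c where
  proper := h.proper
  uncolored := h.uncolored
  degree_le := h.degree_le
  one_le := ⟨h.one_le.1, h.one_le.2.2, h.one_le.2.1⟩
  le := ⟨h.le.1, h.le.2.2, h.le.2.1⟩
  ne := ⟨h.ne.2.1, h.ne.1, h.ne.2.2.symm⟩
  small x hx := h.small x (by tauto)

theorem exists_neighbor (h : Config G k d v i j l c) (hf : ¬ HasFree G k v c) :
    ∃ x, G.Adj v x ∧ c x = i := by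
  by_contra hcon
  push Not at hcon
  exact hf ⟨i, h.one_le.1, h.le.1, hcon⟩

theorem swap (h : Config G k d v i j l c) {u : Fin n} (hu : c u = i) :
    Config G k d v i j l (swap G d c u j) where
  proper := h.proper.swap (by have := h.one_le; omega)
  uncolored := (swap_eq_zero (by have := h.one_le; omega) v).2 h.uncolored
  degree_le := h.degree_le
  one_le := h.one_le
  le := h.le
  ne := h.ne
  small x hx := by
    refine h.small x ?_
    rcases swap_cases (G := G) d c u j with he | ⟨_, _, he⟩
    · rwa [he] at hx
    · by_cases hr : (chain G c (c u) j).Reachable u x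
      · have := chain_color (.inl rfl) hr
        omega
      · rwa [(he x).2 hr] at hx

/-- Recoloring `u` with a free color is an exchange on a single vertex, so it counts as one step of
`Freeable`. The color `z` may be any color, also one used at vertices of large degree, because `u`
itself has small degree. -/
theorem update (h : Config G k d v i j l c) {u : Fin n} {z : ℕ} (hu : c u = i ∨ c u = j)
    (hz : 1 ≤ z) (hfree : ∀ y, G.Adj u y → c y ≠ z) :
    Config G k d v i j l (Function.update c u z) ∧
      Kempe.swap G d c u z = Function.update c u z := by
  have h1 := h.one_le
  have e : Kempe.swap G d c u z = Function.update c u z :=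
    swap_eq_update h.proper (by omega) (h.small u (by omega)).2 hfree
  refine ⟨⟨e ▸ h.proper.swap (by omega), ?_, h.degree_le, h.one_le, h.le, h.ne, ?_⟩, e⟩
  · rw [← e, swap_eq_zero (by omega), h.uncolored]
  · intro x hx
    by_cases hxu : x = u
    · subst hxu
      exact h.small x (by omega)
    · rw [Function.update_of_ne hxu] at hx
      exact h.small x hx

theorem adj_color (h : Config G k d v i j l c) {x y : Fin n} (hx : c x = i)
    (ha : (chain G c i j).Adj x y) : c y = j := by
  have h1 := h.proper x y ha.1 (by have := h.one_le; omega)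
  have h2 := ha.2.2
  omega

theorem adj_color' (h : Config G k d v i j l c) {x y : Fin n} (hx : c x = j)
    (ha : (chain G c i j).Adj x y) : c y = i :=
  h.comm₁₂.adj_color hx (chain_comm G c i j ▸ ha)

/-- The neighbors of `v` of two colors are in the same component of the subgraph of these
colors. -/
theorem reachable (h : Config G k d v i j l c) (hf : ¬ Freeable G k d v 1 c) {x y : Fin n}
    (hx : G.Adj v x) (hcx : c x = i) (hy : G.Adj v y) (hcy : c y = j) :
    (chain G c i j).Reachable x y := by
  have hf0 : ¬ HasFree G k v c := fun H => hf (.inl H)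
  have h1 := h.one_le
  have h2 := h.ne
  by_contra hcon
  -- If the components differ, the exchange at `x` turns `x` into color `j` and leaves `y` alone, so
  -- that color `i` becomes free at `v`.
  refine hf (.inr ⟨x, j, h1.2.1, h.le.2.1, i, h1.1, h.le.1, fun w hw hwi => ?_⟩)
  by_cases hr : (chain G c (c x) j).Reachable x w
  · rw [swap_apply_of_reachable (by omega) (fun y hy => (h.small y (by omega)).2) hr] at hwi
    have h3 := chain_color (.inl rfl) hr
    obtain rfl := eq_of_not_hasFree hf0 h.degree_le hw hy (by omega)
    rw [hcx] at hr
    exact hcon hr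
  · rw [swap_apply_of_not_reachable hr] at hwi
    obtain rfl := eq_of_not_hasFree hf0 h.degree_le hw hx (by omega)
    exact hr (.refl _)

/-- A neighbor of `v` cannot get another color. -/
theorem not_free (h : Config G k d v i j l c) (hf : ¬ Freeable G k d v 1 c) {x : Fin n}
    (hx : G.Adj v x) (hcx : c x = i) {z : ℕ} (hz : 1 ≤ z) (hzk : z ≤ k) (hzi : z ≠ i) :
    ¬ ∀ y, G.Adj x y → c y ≠ z := by
  intro hfree
  have hf0 : ¬ HasFree G k v c := fun H => hf (.inl H)
  obtain ⟨_, e⟩ := h.update (.inl hcx) hz hfree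
  refine hf (.inr ⟨x, z, hz, hzk, i, h.one_le.1, h.le.1, fun w hw hwi => ?_⟩)
  rw [e] at hwi
  by_cases hwx : w = x
  · subst hwx
    rw [Function.update_self] at hwi
    exact hzi hwi
  · rw [Function.update_of_ne hwx] at hwi
    exact hwx (eq_of_not_hasFree hf0 h.degree_le hw hx (hwi.trans hcx.symm))

/-- A vertex that can get a third color does not separate the neighbors of `v`. -/
theorem reachable_avoid (h : Config G k d v i j l c) (hf : ¬ Freeable G k d v 2 c) {x y : Fin n}
    (hx : G.Adj v x) (hcx : c x = i) (hy : G.Adj v y) (hcy : c y = j) {u : Fin n}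
    (hu : c u = i ∨ c u = j) (hux : u ≠ x) (huy : u ≠ y) {z : ℕ} (hz : 1 ≤ z) (hzk : z ≤ k)
    (hzi : z ≠ i) (hzj : z ≠ j) (hfree : ∀ y, G.Adj u y → c y ≠ z) :
    ((chain G c i j).avoid u).Reachable x y := by
  obtain ⟨h', e⟩ := h.update hu hz hfree
  have hf' : ¬ Freeable G k d v 1 (Function.update c u z) := fun H =>
    hf (.inr ⟨u, z, hz, hzk, e ▸ H⟩)
  have hr := h'.reachable hf' hx (by rw [Function.update_of_ne hux.symm, hcx]) hy
    (by rw [Function.update_of_ne huy.symm, hcy])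
  -- As `z` is neither `i` nor `j`, the recolored `u` has left the subgraph of these colors, so the
  -- connection found after recoloring avoids `u`.
  refine hr.mono fun a b hab => ?_
  have ha : a ≠ u := by
    rintro rfl
    have := hab.2.1
    rw [Function.update_self] at this
    omega
  have hb : b ≠ u := by
    rintro rfl
    have := hab.2.2
    rw [Function.update_self] at this
    omega
  have h1 := hab.2.1
  have h2 := hab.2.2
  rw [Function.update_of_ne ha] at h1
  rw [Function.update_of_ne hb] at h2
  exact ⟨⟨hab.1, h1, h2⟩, ha, hb⟩

/-- Two neighbors of `x` of color `j` and the uncolored neighbor `v` together contribute only one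
color. So `x` could be recolored, which would free `i` at `v`. -/
theorem unique_neighbor (h : Config G k d v i j l c) (hf : ¬ Freeable G k d v 1 c) {x : Fin n}
    (hx : G.Adj v x) (hcx : c x = i) (p q : Fin n) (hp : (chain G c i j).Adj x p)
    (hq : (chain G c i j).Adj x q) : p = q := by
  by_contra hpq
  have hcp := h.adj_color hcx hp
  have hcq := h.adj_color hcx hq
  have h1 := h.one_le
  have h0 := h.uncolored
  have hqv : q ≠ v := by rintro rfl; omega
  obtain ⟨z, hz, hzk, hzi, hfree⟩ := exists_free (c := c) h.one_le.1 h.le.1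
    (h.small x (.inl hcx)).1 hp.1 hx.symm (by rintro rfl; omega)
    (.inr ⟨q, hq.1, Ne.symm hpq, hqv, by omega⟩) (.inl h0)
  exact h.not_free hf hx hcx hz hzk hzi hfree

/-- The component of the neighbors of `v` of the colors `i` and `j` is a path. -/
theorem component (h : Config G k d v i j l c) (hf : ¬ Freeable G k d v 2 c) {x y w : Fin n}
    (hx : G.Adj v x) (hcx : c x = i) (hy : G.Adj v y) (hcy : c y = j)
    (hw : (chain G c i j).Reachable x w) (hwx : w ≠ x) (hwy : w ≠ y) :
    (∃ p q, p ≠ q ∧ (chain G c i j).Adj w p ∧ (chain G c i j).Adj w q) ∧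
      ¬ ((chain G c i j).avoid w).Reachable x y := by
  have hf1 : ¬ Freeable G k d v 1 c := fun H => hf H.succ
  have hxy : x ≠ y := by have := h.ne; rintro rfl; omega
  refine SimpleGraph.component_is_path hxy (h.unique_neighbor hf1 hx hcx) ?_ ?_
    (h.reachable hf1 hx hcx hy hcy) hw hwx hwy
  · rw [chain_comm]
    exact h.comm₁₂.unique_neighbor hf1 hy hcy
  · intro u p q r hux huy hp hq hr hpq hqr hpr
    have hle := h.le
    have h1 := h.one_le
    have hcol : (c u = i ∧ c p = j ∧ c q = j ∧ c r = j) ∨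
        (c u = j ∧ c p = i ∧ c q = i ∧ c r = i) := by
      rcases hp.2.1 with hu | hu
      · exact .inl ⟨hu, h.adj_color hu hp, h.adj_color hu hq, h.adj_color hu hr⟩
      · exact .inr ⟨hu, h.adj_color' hu hp, h.adj_color' hu hq, h.adj_color' hu hr⟩
    -- A branch vertex `u` has three neighbors of one color: `p` and `q` are redundant beside `r`.
    -- So `u` can get a third color, and hence does not separate `x` from `y`.
    obtain ⟨z, hz, hzk, hzi, hfree⟩ := exists_free (c := c) (a := c u) (u := u) (p := p) (q := q)
      (k := k) (by omega) (by omega) (h.small u (by omega)).1 hp.1 hq.1 hpq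
      (.inr ⟨r, hr.1, hpr.symm, hqr.symm, by omega⟩)
      (.inr ⟨r, hr.1, hpr.symm, hqr.symm, by omega⟩)
    have hzp := hfree p hp.1
    exact h.reachable_avoid hf hx hcx hy hcy (by omega) hux huy hz hzk (by omega) (by omega) hfree

/-- Two components at the same neighbor `x` of `v` meet only in `x`. -/
theorem eq_of_reachable (h : Config G k d v i j l c) (hf : ¬ Freeable G k d v 2 c) {x w : Fin n}
    (hx : G.Adj v x) (hcx : c x = i) (hcw : c w = i) (hj : (chain G c i j).Reachable x w)
    (hl : (chain G c i l).Reachable x w) : w = x := by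
  by_contra hwx
  have hf0 : ¬ HasFree G k v c := fun H => hf (.inl H)
  have h1 := h.one_le
  have h2 := h.ne
  obtain ⟨y, hy, hcy⟩ := h.comm₁₂.exists_neighbor hf0
  obtain ⟨y', hy', hcy'⟩ := h.comm₂₃.comm₁₂.exists_neighbor hf0
  obtain ⟨⟨p, q, hpq, hp, hq⟩, hsep⟩ := h.component hf hx hcx hy hcy hj hwx (by rintro rfl; omega)
  obtain ⟨⟨r, t, hrt, hr, ht⟩, -⟩ :=
    h.comm₂₃.component hf hx hcx hy' hcy' hl hwx (by rintro rfl; omega)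
  have cp := h.adj_color hcw hp
  have cq := h.adj_color hcw hq
  have cr := h.comm₂₃.adj_color hcw hr
  have ct := h.comm₂₃.adj_color hcw ht
  -- Inside both paths, `w` has two neighbors of color `j` and two of color `l`; one of each is
  -- redundant. So `w` can be recolored, although it separates `x` from `y` in the colors `i` and
  -- `j`.
  obtain ⟨z, hz, hzk, hzi, hfree⟩ := exists_free (c := c) (a := i) h1.1 h.le.1
    (h.small w (.inl hcw)).1 hp.1 hr.1 (by rintro rfl; omega)
    (.inr ⟨q, hq.1, hpq.symm, by rintro rfl; omega, by omega⟩)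
    (.inr ⟨t, ht.1, by rintro rfl; omega, hrt.symm, by omega⟩)
  have hzp := hfree p hp.1
  exact hsep (h.reachable_avoid hf hx hcx hy hcy (.inl hcw) hwx (by rintro rfl; omega) hz hzk hzi
    (by omega) hfree)

/-- If the neighbors of `v` of two of the three colors are not adjacent, then three exchanges make
a color free at `v`. -/
theorem freeable (h : Config G k d v i j l c)
    (hna : ∀ x y, G.Adj v x → G.Adj v y → c x = i → c y = j → ¬ G.Adj x y) :
    Freeable G k d v 3 c := by
  by_contra hf3
  have hf : ¬ Freeable G k d v 2 c := fun H => hf3 H.succ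
  have hf1 : ¬ Freeable G k d v 1 c := fun H => hf H.succ
  have hf0 : ¬ HasFree G k v c := fun H => hf (.inl H)
  have h1 := h.one_le
  have h2 := h.ne
  obtain ⟨x, hx, hcx⟩ := h.exists_neighbor hf0
  obtain ⟨y, hy, hcy⟩ := h.comm₁₂.exists_neighbor hf0
  have hxy : x ≠ y := by rintro rfl; omega
  have hr := h.reachable hf1 hx hcx hy hcy
  obtain ⟨w, hw⟩ : ∃ w, (chain G c i j).Adj x w := by
    by_contra hcon
    push Not at hcon
    refine hxy (hr.of_closed (fun b => x = b) rfl ?_)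
    rintro a b rfl hab
    exact absurd hab (hcon b)
  -- Here `w` is the vertex after `x` on the path to `y`; it has color `j` and differs from `y` as
  -- `x` and `y` are not adjacent.
  have hcw := h.adj_color hcx hw
  have hwy : w ≠ y := by
    rintro rfl
    exact hna x w hx hy hcx hcy hw.1
  have hav : ((chain G c i j).avoid x).Reachable w y := by
    have : y = x ∨ ((chain G c i j).avoid x).Reachable w y := by
      refine hr.of_closed (fun b => b = x ∨ ((chain G c i j).avoid x).Reachable w b) (.inl rfl) ?_
      rintro a b (rfl | ha) hab
      · right
        rw [h.unique_neighbor hf1 hx hcx b w hab hw]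
      · by_cases hax : a = x
        · subst hax
          right
          rw [h.unique_neighbor hf1 hx hcx b w hab hw]
        · by_cases hbx : b = x
          · exact .inl hbx
          · have hadj : ((chain G c i j).avoid x).Adj a b := ⟨hab, hax, hbx⟩
            exact .inr (ha.trans hadj.reachable)
    exact this.resolve_left hxy.symm
  -- Exchange `i` and `l` at `x`. This costs one of the three exchanges and leaves two for the
  -- lemmas on the new coloring `c'`.
  have h' := h.comm₂₃.swap hcx
  have hf' : ¬ Freeable G k d v 2 (Kempe.swap G d c x l) := fun H =>
    hf3 (.inr ⟨x, l, h1.2.2, h.le.2.2, H⟩)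
  set c' := Kempe.swap G d c x l with hc'
  have same : ∀ b, ¬ (chain G c i l).Reachable x b → c' b = c b := fun b hb =>
    swap_apply_of_not_reachable (by rwa [hcx])
  have samej : ∀ b, c b = j → c' b = j := fun b hb => by
    rw [same b (fun H => by have := chain_color (.inl hcx) H; omega), hb]
  have hc'x : c' x = l := by
    rw [hc', swap_apply_of_reachable (by omega) (fun y hy => (h.small y (by omega)).2) (.refl _)]
    omega
  -- Now `x` has color `l`, so it is joined to `y` in the colors `j` and `l`, and `w` is adjacent to
  -- it.
  have r1 : (chain G c' j l).Reachable y w := by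
    have ha : (chain G c' j l).Adj x w := ⟨hw.1, .inr hc'x, .inl (samej w hcw)⟩
    exact (h'.comm₂₃.comm₁₂.comm₂₃.reachable (fun H => hf' H.succ) hy (samej y hcy) hx
      hc'x).trans ha.reachable
  -- The rest of the path from `w` to `y` keeps its colors: by `eq_of_reachable`, its vertices of
  -- color `i` are outside the exchanged component, which meets the path only in `x`.
  have r2 : (chain G c' i j).Reachable w y := by
    have key : ∀ b, (chain G c i j).Reachable x b → b ≠ x → c' b = c b := by
      intro b hb hbx
      rcases chain_color (.inl hcx) hb with hi | hj
      · exact same b fun H => hbx (h.eq_of_reachable hf hx hcx hi hb H)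
      · rw [samej b hj, hj]
    have : (chain G c i j).Reachable x y ∧ y ≠ x ∧ (chain G c' i j).Reachable w y := by
      refine hav.of_closed (fun b => (chain G c i j).Reachable x b ∧ b ≠ x ∧
        (chain G c' i j).Reachable w b) ⟨hw.reachable, hw.1.ne', .refl _⟩ ?_
      rintro a b ⟨ha, hax, har⟩ hab
      have hb := ha.trans hab.1.reachable
      refine ⟨hb, hab.2.2, har.trans ?_⟩
      have hadj : (chain G c' i j).Adj a b := by
        refine ⟨hab.1.1, ?_, ?_⟩
        · rw [key a ha hax]; exact hab.1.2.1
        · rw [key b hb hab.2.2]; exact hab.1.2.2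
      exact hadj.reachable
    exact this.2.2
  -- So `w` lies on both paths from `y`, which may meet in no vertex of color `j` other than `y`.
  exact hwy (h'.comm₂₃.comm₁₂.eq_of_reachable hf' hy (samej y hcy) (samej w hcw)
    (by rw [chain_comm]; exact r2.symm) r1)

/-- In a graph without cliques of size four, three exchanges make a color free at `v`. -/
theorem freeable_of_cliqueFree (h : Config G k d v i j l c) (hG : G.CliqueFree 4) :
    Freeable G k d v 3 c := by
  by_contra hf3
  have hf0 : ¬ HasFree G k v c := fun H => hf3 (.inl H)
  obtain ⟨x, hx, hcx⟩ := h.exists_neighbor hf0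
  obtain ⟨y, hy, hcy⟩ := h.comm₁₂.exists_neighbor hf0
  obtain ⟨z, hz, hcz⟩ := h.comm₂₃.comm₁₂.exists_neighbor hf0
  have aux : ∀ {i j l x y}, Config G k d v i j l c → G.Adj v x → c x = i → G.Adj v y → c y = j →
      G.Adj x y := by
    intro i j l x y h hx hcx hy hcy
    by_contra hxy
    refine hf3 (h.freeable fun x' y' hx' hy' hcx' hcy' => ?_)
    rwa [eq_of_not_hasFree hf0 h.degree_le hx' hx (hcx'.trans hcx.symm),
      eq_of_not_hasFree hf0 h.degree_le hy' hy (hcy'.trans hcy.symm)]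
  have hxy := aux h hx hcx hy hcy
  have hxz := aux h.comm₂₃ hx hcx hz hcz
  have hyz := aux h.comm₁₂.comm₂₃ hy hcy hz hcz
  refine hG (insert v {x, y, z}) (SimpleGraph.IsNClique.insert
    (SimpleGraph.is3Clique_triple_iff.2 ⟨hxy, hxz, hyz⟩) ?_)
  simp [hx, hy, hz]

end Config

end Kempe

/-! ### Induced odd cycles in graphs that are not bipartite -/

namespace SimpleGraph

variable {V : Type*} {G : SimpleGraph V}

/-- The part of a walk between the positions `i ≤ j`, up to the length. -/
theorem Walk.exists_segment {u v : V} (w : G.Walk u v) {i j : ℕ} (hij : i ≤ j)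
    (_hj : j ≤ w.length) :
    ∃ p : G.Walk (w.getVert i) (w.getVert j), p.length = j - i := by
  have h : (w.drop i).getVert (j - i) = w.getVert j := by
    rw [Walk.drop_getVert]; congr 1; omega
  refine ⟨((w.drop i).take (j - i)).copy rfl h, ?_⟩
  rw [Walk.length_copy, Walk.take_length, Walk.drop_length]
  exact min_eq_left (by omega)

/-- On a closed walk one can continue from position `j` to the end and then from the start to
position `i`. -/
theorem Walk.exists_complementary_segment {u : V} (w : G.Walk u u) {i : ℕ} (j : ℕ) (hi : i ≤ w.length) :
    ∃ p : G.Walk (w.getVert j) (w.getVert i), p.length = w.length - j + i := by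
  refine ⟨(w.drop j).append (w.take i), ?_⟩
  rw [Walk.length_append, Walk.take_length, Walk.drop_length]
  omega

theorem cycleGraph_adj_iff_of_lt {k : ℕ} {a b : Fin k} (hab : a < b) :
    (cycleGraph k).Adj a b ↔ (b : ℕ) = a + 1 ∨ ((a : ℕ) = 0 ∧ (b : ℕ) + 1 = k) := by
  have hab' : (a : ℕ) < b := hab
  rw [cycleGraph_adj', Fin.sub_val_of_le hab.le, Fin.coe_sub_iff_lt.2 hab]
  omega

/-- A graph that is not two-colorable has an induced odd cycle. -/
theorem exists_induced_odd_cycle (h : ¬ G.Colorable 2) :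
    ∃ k, 3 ≤ k ∧ Odd k ∧ Nonempty (cycleGraph k ↪g G) := by
  classical
  rw [two_colorable_iff_forall_loop_even] at h
  push Not at h
  -- A shortest odd closed walk is an induced cycle.
  have hex : ∃ k, ∃ u, ∃ w : G.Walk u u, Odd k ∧ w.length = k := by
    obtain ⟨u, w, hw⟩ := h
    exact ⟨w.length, u, w, by simpa using hw, rfl⟩
  obtain ⟨u, w, hodd, hlen⟩ := Nat.find_spec hex
  have hmin : ∀ m, m < Nat.find hex → ∀ x (p : G.Walk x x), p.length = m → ¬ Odd m :=
    fun m hm x p hp ho => Nat.find_min hex hm ⟨x, p, ho, hp⟩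
  generalize Nat.find hex = k at *
  have hk : 3 ≤ k := by
    rcases hodd with ⟨m, rfl⟩
    rcases Nat.eq_zero_or_pos m with rfl | hm
    · have := w.adj_getVert_succ (i := 0) (by omega)
      have h1 : w.getVert 1 = u := by
        have := w.getVert_length; rwa [hlen] at this
      simp [h1] at this
    · omega
  -- A repeated vertex or a chord splits the walk into two shorter closed walks with total length
  -- `k` or `k + 2`. One of these is odd, against minimality.
  have key : ∀ i j : ℕ, i < j → j < k → w.getVert i ≠ w.getVert j ∧
      (G.Adj (w.getVert i) (w.getVert j) → j = i + 1 ∨ (i = 0 ∧ j + 1 = k)) := by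
    intro i j hij hj
    obtain ⟨p, hp⟩ := w.exists_segment hij.le (by omega)
    obtain ⟨q, hq⟩ := w.exists_complementary_segment (i := i) j (by omega)
    constructor
    · intro he
      have h1 := hmin (j - i) (by omega) _ (p.copy rfl he.symm) (by simpa using hp)
      have h2 := hmin (k - j + i) (by omega) _ (q.copy rfl he) (by simpa [hlen] using hq)
      rw [Nat.not_odd_iff_even] at h1 h2
      have h3 := h1.add h2
      rw [show j - i + (k - j + i) = k by omega] at h3
      exact Nat.not_even_iff_odd.2 hodd h3
    · intro ha
      by_contra hcon
      have h1 := hmin (j - i + 1) (by omega) _ (p.concat ha.symm) (by simpa using hp)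
      have h2 := hmin (k - j + i + 1) (by omega) _ (q.concat ha) (by simpa [hlen] using hq)
      rw [Nat.not_odd_iff_even] at h1 h2
      have h3 := h1.add h2
      rw [show j - i + 1 + (k - j + i + 1) = k + 2 by omega] at h3
      exact Nat.not_even_iff_odd.2 hodd (by simpa [Nat.even_add] using h3)
  have hend : w.getVert k = u := by
    have := w.getVert_length; rwa [hlen] at this
  have adj : ∀ a b : Fin k, a < b →
      (G.Adj (w.getVert a) (w.getVert b) ↔ (cycleGraph k).Adj a b) := by
    intro a b hab
    rw [cycleGraph_adj_iff_of_lt hab]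
    refine ⟨(key a b hab b.2).2, ?_⟩
    rintro (h1 | ⟨h0, h1⟩)
    · rw [h1]; exact w.adj_getVert_succ (by omega)
    · have := w.adj_getVert_succ (i := b) (by omega)
      rw [h1, hend] at this
      rw [h0, w.getVert_zero]
      exact this.symm
  refine ⟨k, hk, hodd, ⟨⟨⟨fun a => w.getVert a, ?_⟩, ?_⟩⟩⟩
  · intro a b hab
    rcases lt_trichotomy a b with hlt | rfl | hlt
    · exact absurd hab (key a b hlt b.2).1
    · rfl
    · exact absurd hab.symm (key b a hlt a.2).1
  · intro a b
    change G.Adj (w.getVert a) (w.getVert b) ↔ _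
    rcases lt_trichotomy a b with hlt | rfl | hlt
    · exact adj a b hlt
    · simp
    · rw [G.adj_comm, adj b a hlt, SimpleGraph.adj_comm]

end SimpleGraph

/-- If every induced odd cycle has a vertex of degree at most `3`, then the vertices of degree at
least `4` can be colored properly with two colors. -/
theorem OddCyclesHaveLowDegree.exists_bicoloring {n : ℕ} {G : SimpleGraph (Fin n)}
    [DecidableRel G.Adj] (h : OddCyclesHaveLowDegree G) :
    ∃ f : Fin n → Bool, ∀ x y, G.Adj x y → 4 ≤ G.degree x → 4 ≤ G.degree y → f x ≠ f y := by
  classical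
  have hc : (G.induce {v | 4 ≤ G.degree v}).Colorable 2 := by
    by_contra hcon
    obtain ⟨k, hk, ho, ⟨f⟩⟩ := SimpleGraph.exists_induced_odd_cycle hcon
    obtain ⟨i, hi⟩ := h k hk ho (f.trans (SimpleGraph.Embedding.induce _))
    have := (f i).2
    simp only [Set.mem_ofPred_eq] at this
    have e : (f.trans (SimpleGraph.Embedding.induce _)) i = (f i : Fin n) := rfl
    rw [e] at hi
    omega
  obtain ⟨C⟩ := hc
  refine ⟨fun x => if hx : 4 ≤ G.degree x then decide (C ⟨x, hx⟩ = 0) else true, ?_⟩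
  intro x y hxy hx hy
  have hne : C ⟨x, hx⟩ ≠ C ⟨y, hy⟩ := C.valid (by simpa using hxy)
  simp only [hx, hy, dif_pos]
  intro he
  rw [decide_eq_decide] at he
  generalize C ⟨x, hx⟩ = a at *
  generalize C ⟨y, hy⟩ = b at *
  fin_cases a <;> fin_cases b <;> simp_all

/-! ### Loops over the vertices and smallest free colors -/

namespace RAM

namespace Cmd

infixr:60 " ;; " => Cmd.seq

@[simp] theorem run_skip (s : State) : skip.run s = s := rfl

@[simp] theorem run_assign (r : ℕ) (e : Expr) (s : State) :
    (assign r e).run s = s.set r (e.eval s) := rfl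

@[simp] theorem run_store (a : ℕ) (i e : Expr) (s : State) :
    (store a i e).run s = s.put a (i.eval s) (e.eval s) := rfl

@[simp] theorem run_seq (p q : Cmd) (s : State) : (p ;; q).run s = q.run (p.run s) := rfl

@[simp] theorem run_cond (e : Expr) (p q : Cmd) (s : State) :
    (cond e p q).run s = if e.eval s = 0 then q.run s else p.run s := rfl

end Cmd

@[simp] theorem eval_const (s : State) (c : ℕ) : (Expr.const c).eval s = c := rfl
@[simp] theorem eval_var (s : State) (r : ℕ) : (Expr.var r).eval s = s.reg r := rfl
@[simp] theorem eval_read (s : State) (a : ℕ) (i : Expr) :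
    (Expr.read a i).eval s = s.arr a (i.eval s) := rfl
@[simp] theorem eval_plus (s : State) (e f : Expr) :
    (Expr.plus e f).eval s = e.eval s + f.eval s := rfl
@[simp] theorem eval_minus (s : State) (e f : Expr) :
    (Expr.minus e f).eval s = e.eval s - f.eval s := rfl

/-- An expression that is nonzero iff `e = f`. -/
def eqE (e f : Expr) : Expr := .minus (.const 1) (.plus (.minus e f) (.minus f e))

/-- An expression that is nonzero iff `e` and `f` are. -/
def andE (e f : Expr) : Expr :=
  .minus (.const 1) (.plus (.minus (.const 1) e) (.minus (.const 1) f))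

theorem eval_eqE {s : State} {e f : Expr} : (eqE e f).eval s ≠ 0 ↔ e.eval s = f.eval s := by
  simp only [eqE, eval_minus, eval_plus, eval_const]; omega

theorem eval_andE {s : State} {e f : Expr} :
    (andE e f).eval s ≠ 0 ↔ e.eval s ≠ 0 ∧ f.eval s ≠ 0 := by
  simp only [andE, eval_minus, eval_plus, eval_const]; omega

/-- Set register `q` to `w` if `e` is nonzero for some value of the loop register `r`. -/
def flag (r q w : ℕ) (e : Expr) : Cmd :=
  .iter r none (.cond e (.assign q (.const w)) .skip)

/-- For all values of the loop register `r`, if `g` is nonzero, write `e` to cell `r` of array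
`a`. -/
def fill (r a : ℕ) (g e : Expr) : Cmd :=
  .iter r none (.cond g (.store a (.var r) e) .skip)

-- The test must not depend on register `q`, which changes during the loop; hence `hP` speaks of all
-- states that agree with `s` outside `r` and `q`.
open Classical in
theorem run_flag {r q w : ℕ} {e : Expr} (s : State) (hq : q ≠ r) (P : ℕ → Prop)
    (hP : ∀ i t, i < s.reg 0 → (∀ p, p ≠ r → p ≠ q → t.reg p = s.reg p) → t.arr = s.arr →
      t.reg r = i → (e.eval t ≠ 0 ↔ P i)) :
    ((flag r q w e).run s).reg q = if ∃ i, i < s.reg 0 ∧ P i then w else s.reg q := by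
  obtain ⟨t, hI, hrun, -, -⟩ := Cmd.run_iter (r := r) (b := none)
    (c := .cond e (.assign q (.const w)) .skip)
    (fun i t => t.reg q = if ∃ j, j < i ∧ P j then w else s.reg q) s (by simp) (by
      intro i t hi hr ha hI
      have hw : ∀ p, p ≠ q → (Cmd.cond e (.assign q (.const w)) .skip).writesReg p = false := by
        intro p hp; simp [Cmd.writesReg, hp]
      have := hP i (t.set r i) hi (fun p hp hpq => by
        rw [State.set_reg, if_neg hp]; exact hr p hp (hw p hpq))
        (funext fun a => ha a rfl) (by simp)
      rw [Cmd.run_cond]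
      by_cases he : e.eval (t.set r i) = 0
      · rw [if_pos he, Cmd.run_skip, State.set_reg, if_neg hq, hI]
        have hPi : ¬ P i := fun h => this.2 h he
        have : (∃ j, j < i ∧ P j) ↔ ∃ j, j < i + 1 ∧ P j :=
          ⟨fun ⟨j, hj, h⟩ => ⟨j, by omega, h⟩, fun ⟨j, hj, h⟩ =>
            ⟨j, lt_of_le_of_ne (by omega) (fun e => hPi (e ▸ h)), h⟩⟩
        simp only [this]
      · rw [if_neg he, if_pos ⟨i, by omega, this.1 he⟩]
        simp)
  rw [flag, hrun, State.set_reg, if_neg hq, hI]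
  rfl

/-- Cell `i` is written in round `i` only, so `e` and `g` still see its old content then. Nothing is
assumed about the other cells of array `a`, some of which have been overwritten. -/
theorem run_fill {r a : ℕ} {g e : Expr} (s : State) (F : ℕ → ℕ)
    (hF : ∀ i t, i < s.reg 0 → (∀ p, p ≠ r → t.reg p = s.reg p) → (∀ b, b ≠ a → t.arr b = s.arr b) →
      t.reg r = i → t.arr a i = s.arr a i →
      (if g.eval t = 0 then s.arr a i else e.eval t) = F i) :
    ∀ i, i < s.reg 0 → ((fill r a g e).run s).arr a i = F i := by
  obtain ⟨t, hI, hrun, -, -⟩ := Cmd.run_iter (r := r) (b := none)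
    (c := .cond g (.store a (.var r) e) .skip)
    (fun i t => (∀ j, j < i → t.arr a j = F j) ∧ ∀ j, i ≤ j → t.arr a j = s.arr a j) s
    (by simp) (by
      rintro i t hi hr ha ⟨hI, hI'⟩
      have hw : ∀ b, b ≠ a → (Cmd.cond g (.store a (.var r) e) .skip).writesArr b = false := by
        intro b hb; simp [Cmd.writesArr, hb]
      have := hF i (t.set r i) hi (fun p hp => by
        rw [State.set_reg, if_neg hp]; exact hr p hp rfl)
        (fun b hb => ha b (hw b hb)) (by simp) (hI' i le_rfl)
      rw [Cmd.run_cond]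
      split_ifs with he
      · rw [if_pos he] at this
        refine ⟨fun j hj => ?_, fun j hj => hI' j (by omega)⟩
        rcases Nat.lt_succ_iff_lt_or_eq.1 hj with h | rfl
        · exact hI j h
        · exact (hI' j le_rfl).trans this
      · rw [if_neg he] at this
        refine ⟨fun j hj => ?_, fun j hj => ?_⟩
        · by_cases hji : j = i
          · subst hji; simp [this]
          · simp [hji, hI j (by omega)]
        · have hji : j ≠ i := by omega
          simp [hji, hI' j (by omega)])
  intro i hi
  rw [fill, hrun]
  exact hI.1 i hi

variable {n : ℕ} {G : SimpleGraph (Fin n)} [DecidableRel G.Adj]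

variable (G) in
/-- The memory holds the graph: `n` in register `0`, adjacency matrix in array `0`, the positions
of its rows in array `2` and the degrees in array `3`. -/
structure Ready (s : State) : Prop where
  size : s.reg 0 = n
  adj : ∀ i j : Fin n, s.arr 0 (s.arr 2 i + j) = if G.Adj i j then 1 else 0
  deg : ∀ i : Fin n, s.arr 3 i = G.degree i

theorem Ready.of_eq {s s' : State} (h : Ready G s) (h0 : s'.reg 0 = s.reg 0)
    (a0 : s'.arr 0 = s.arr 0) (a2 : s'.arr 2 = s.arr 2) (a3 : s'.arr 3 = s.arr 3) :
    Ready G s' where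
  size := h0.trans h.size
  adj i j := by rw [a0, a2]; exact h.adj i j
  deg i := by rw [a3]; exact h.deg i

theorem Ready.run {s : State} (h : Ready G s) {c : Cmd} (h0 : c.writesReg 0 = false)
    (a0 : c.writesArr 0 = false) (a2 : c.writesArr 2 = false) (a3 : c.writesArr 3 = false) :
    Ready G (c.run s) :=
  h.of_eq (Cmd.run_reg h0 s) (Cmd.run_arr a0 s) (Cmd.run_arr a2 s) (Cmd.run_arr a3 s)

/-- The current coloring, held in array `4`. -/
def colors (n : ℕ) (s : State) (x : Fin n) : ℕ := s.arr 4 x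

theorem colors_congr {s s' : State} (h : s'.arr 4 = s.arr 4) : colors n s' = colors n s := by
  funext x; simp only [colors, h]

/-- The entry of the adjacency matrix at the positions in two registers. -/
def adjE (x y : ℕ) : Expr := .read 0 (.plus (.read 2 (.var x)) (.var y))

theorem Ready.eval_adjE {s : State} (h : Ready G s) {p q : ℕ} {x y : Fin n} (hx : s.reg p = x)
    (hy : s.reg q = y) : (adjE p q).eval s ≠ 0 ↔ G.Adj x y := by
  simp only [adjE, eval_read, eval_plus, eval_var, hx, hy, h.adj]
  split_ifs with h <;> simp [h]

/-- The smallest color that does not occur at the neighbors of a vertex. -/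
structure IsMinFree (G : SimpleGraph (Fin n)) (c : Fin n → ℕ) (x : Fin n) (f : ℕ) : Prop where
  one_le : 1 ≤ f
  free : ∀ y, G.Adj x y → c y ≠ f
  min : ∀ g, 1 ≤ g → g < f → ∃ y, G.Adj x y ∧ c y = g

/-- Set register `3` to `1` or `0` according to whether `g` is nonzero for some neighbor of the
vertex in register `v`; the neighbor is in register `4`. -/
def scan (v : ℕ) (g : Expr) : Cmd :=
  .assign 3 (.const 0) ;; flag 4 3 1 (andE (adjE v 4) g)

theorem scan_writesReg (v : ℕ) (g : Expr) {q : ℕ} (h3 : q ≠ 3) (h4 : q ≠ 4) :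
    (scan v g).writesReg q = false := by
  simp [scan, flag, Cmd.writesReg, h3, h4]

theorem Ready.scan_spec {s : State} (h : Ready G s) {v : ℕ} (hv : 5 ≤ v) {x : Fin n}
    (hx : s.reg v = x) {g : Expr} (Q : Fin n → Prop)
    (hQ : ∀ (y : Fin n) t, t.arr = s.arr → (∀ p, p ≠ 3 → p ≠ 4 → t.reg p = s.reg p) →
      t.reg 4 = (y : ℕ) → (g.eval t ≠ 0 ↔ Q y)) :
    ((scan v g).run s).reg 3 ≠ 0 ↔ ∃ y, G.Adj x y ∧ Q y := by
  classical
  rw [scan, Cmd.run_seq, Cmd.run_assign, eval_const,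
    run_flag (r := 4) (q := 3) (s.set 3 0) (by decide)
      (fun j => ∃ y : Fin n, (y : ℕ) = j ∧ G.Adj x y ∧ Q y)]
  · have : (∃ i, i < (s.set 3 0).reg 0 ∧ ∃ y : Fin n, (y : ℕ) = i ∧ G.Adj x y ∧ Q y) ↔
        ∃ y, G.Adj x y ∧ Q y := by
      constructor
      · rintro ⟨_, _, y, _, h⟩; exact ⟨y, h⟩
      · rintro ⟨y, hy⟩; exact ⟨y, by simp [h.size], y, rfl, hy⟩
    simp only [this]
    split_ifs with hy <;> simp [hy]
  · intro j t hj hr ha h4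
    have hj : j < n := by simpa [h.size] using hj
    have hr' : ∀ p, p ≠ 3 → p ≠ 4 → t.reg p = s.reg p := fun p h3 h4 => by
      rw [hr p h4 h3, State.set_reg, if_neg h3]
    have hrd : Ready G t := h.of_eq (hr' 0 (by decide) (by decide)) (by rw [ha]; rfl)
      (by rw [ha]; rfl) (by rw [ha]; rfl)
    rw [eval_andE, hrd.eval_adjE (y := ⟨j, hj⟩) (by rw [hr' v (by omega) (by omega), hx]) h4,
      hQ ⟨j, hj⟩ t ha hr' h4]
    constructor
    · exact fun H => ⟨⟨j, hj⟩, rfl, H⟩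
    · rintro ⟨y, rfl, H⟩; exact H

/-- Put the smallest color that is free at the vertex in register `v` into register `1`. -/
def minFree (v : ℕ) : Cmd :=
  .assign 1 (.const 0) ;;
  .iter 2 none (.cond (.var 1) .skip (
    scan v (eqE (.read 4 (.var 4)) (.plus (.var 2) (.const 1))) ;;
    .cond (.var 3) .skip (.assign 1 (.plus (.var 2) (.const 1)))))

theorem minFree_writesReg {v q : ℕ} (hq : q = 0 ∨ 5 ≤ q) : (minFree v).writesReg q = false := by
  have h := scan_writesReg v (eqE (.read 4 (.var 4)) (.plus (.var 2) (.const 1))) (q := q)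
    (by omega) (by omega)
  simp [minFree, Cmd.writesReg, h, show q ≠ 1 by omega, show q ≠ 2 by omega]

theorem minFree_arr (v : ℕ) (s : State) : ((minFree v).run s).arr = s.arr :=
  funext fun _ => Cmd.run_arr rfl s

theorem Ready.minFree_spec {s : State} (h : Ready G s) {v : ℕ} (hv : 5 ≤ v) {x : Fin n}
    (hx : s.reg v = x) : IsMinFree G (colors n s) x (((minFree v).run s).reg 1) := by
  rw [minFree, Cmd.run_seq, Cmd.run_assign, eval_const]
  obtain ⟨t, hI, hrun, -, -⟩ := Cmd.run_iter (r := 2) (b := none)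
    (c := .cond (.var 1) .skip (
      scan v (eqE (.read 4 (.var 4)) (.plus (.var 2) (.const 1))) ;;
      .cond (.var 3) .skip (.assign 1 (.plus (.var 2) (.const 1)))))
    -- Register `1` is `0` as long as all colors tested so far occur; round `i` tests color `i + 1`.
    (fun i t => (t.reg 1 ≠ 0 → IsMinFree G (colors n s) x (t.reg 1)) ∧
      (t.reg 1 = 0 → ∀ g, 1 ≤ g → g ≤ i → ∃ y, G.Adj x y ∧ colors n s y = g)) (s.set 1 0)
    (by simp; omega) (by
      rintro i t hi hr ha ⟨hI, hI'⟩
      have hz : t.reg 0 = s.reg 0 := by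
        rw [hr 0 (by decide) rfl]; simp
      have harr : t.arr = s.arr := funext fun a => ha a rfl
      have hv' : t.reg v = x := by
        rw [hr v (by omega) (by
          simp [Cmd.writesReg, scan_writesReg v _ (show v ≠ 3 by omega) (by omega),
            show v ≠ 1 by omega]), State.set_reg, if_neg (by omega), hx]
      rw [Cmd.run_cond]
      by_cases h1 : t.reg 1 = 0
      · rw [if_pos (by simpa using h1), Cmd.run_seq]
        have hrd : Ready G (t.set 2 i) := h.of_eq (by simpa using hz) (by simp [harr])
          (by simp [harr]) (by simp [harr])
        have hsc := hrd.scan_spec hv (x := x) (g := eqE (.read 4 (.var 4)) (.plus (.var 2) (.const 1)))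
          (by rw [State.set_reg, if_neg (by omega), hv'])
          (fun y => colors n s y = i + 1) (by
            intro y t' ha' hr' h4
            rw [eval_eqE]
            simp [ha', harr, h4, hr' 2, colors])
        have h1' : ((scan v (eqE (.read 4 (.var 4)) (.plus (.var 2) (.const 1)))).run
            (t.set 2 i)).reg 1 = 0 := by
          rw [Cmd.run_reg rfl]; simpa using h1
        have h2' : ((scan v (eqE (.read 4 (.var 4)) (.plus (.var 2) (.const 1)))).run
            (t.set 2 i)).reg 2 = i := by
          rw [Cmd.run_reg rfl]; simp
        generalize (scan v (eqE (.read 4 (.var 4)) (.plus (.var 2) (.const 1)))).run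
            (t.set 2 i) = t₂ at *
        rw [Cmd.run_cond]
        by_cases h3 : t₂.reg 3 = 0
        · rw [if_pos (by simpa using h3)]
          have hno : ∀ y, G.Adj x y → colors n s y ≠ i + 1 := fun y hy hc =>
            hsc.2 ⟨y, hy, hc⟩ h3
          simp only [Cmd.run_assign, eval_plus, eval_var, eval_const, State.set_reg, if_true, h2']
          exact ⟨fun _ => ⟨by omega, hno, fun g hg hgi => hI' h1 g hg (by omega)⟩,
            fun h => by omega⟩
        · rw [if_neg (by simpa using h3), Cmd.run_skip]
          refine ⟨fun h => absurd h1' h, fun _ g hg hgi => ?_⟩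
          rcases hgi.lt_or_eq with hlt | rfl
          · exact hI' h1 g hg (by omega)
          · exact hsc.1 h3
      · rw [if_neg (by simpa using h1)]
        simp [h1, hI h1])
  rw [hrun, State.set_reg, if_neg (by decide)]
  -- Had no color been found in `n` rounds, `n` colors would occur at fewer than `n` neighbors.
  refine hI.1 fun h0 => ?_
  have hall := hI.2 h0
  simp only [rounds, State.set_reg, h.size] at hall
  have hsub : Finset.Icc 1 n ⊆ (G.neighborFinset x).image (colors n s) := by
    intro g hg
    rw [Finset.mem_Icc] at hg
    obtain ⟨y, hy, hc⟩ := hall g hg.1 (by simpa using hg.2)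
    exact Finset.mem_image.2 ⟨y, by simpa, hc⟩
  have h1 := Finset.card_le_card hsub
  have h2 := Finset.card_image_le (s := G.neighborFinset x) (f := colors n s)
  have h3 := G.degree_lt_card_verts x
  rw [G.card_neighborFinset_eq_degree] at h2
  rw [Nat.card_Icc, Nat.add_sub_cancel] at h1
  rw [Fintype.card_fin] at h3
  omega

end RAM

/-! ### Marking two-colored components and exchanging their colors -/

namespace RAM

variable {n : ℕ} {G : SimpleGraph (Fin n)} [DecidableRel G.Adj]

theorem eval_plus_ne_zero {s : State} {e f : Expr} :
    (Expr.plus e f).eval s ≠ 0 ↔ e.eval s ≠ 0 ∨ f.eval s ≠ 0 := by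
  rw [eval_plus]; omega

theorem Ready.run_fill {s : State} (h : Ready G s) {r a : ℕ} {g e : Expr} (hr : r ≠ 0)
    (ha : 0 ≠ a ∧ 2 ≠ a ∧ 3 ≠ a)
    (F : Fin n → ℕ)
    (hF : ∀ (i : Fin n) t, Ready G t → (∀ p, p ≠ r → t.reg p = s.reg p) →
      (∀ b, b ≠ a → t.arr b = s.arr b) → t.reg r = (i : ℕ) → t.arr a i = s.arr a i →
      (if g.eval t = 0 then s.arr a i else e.eval t) = F i) (i : Fin n) :
    ((fill r a g e).run s).arr a i = F i := by
  rw [RAM.run_fill s (fun i => if hi : i < n then F ⟨i, hi⟩ else 0) _ i (by rw [h.size]; exact i.2),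
    dif_pos i.2]
  intro j t hj hreg harr hjr hja
  have hj : j < n := by rwa [h.size] at hj
  rw [dif_pos hj]
  exact hF ⟨j, hj⟩ t (h.of_eq (hreg 0 hr.symm) (harr 0 ha.1) (harr 2 ha.2.1)
    (harr 3 ha.2.2)) hreg harr hjr hja

open Classical in
theorem Ready.run_flag {s : State} (h : Ready G s) {r q w : ℕ} {e : Expr} (hr : r ≠ 0) (hq0 : q ≠ 0)
    (hq : q ≠ r) (P : Fin n → Prop)
    (hP : ∀ (i : Fin n) t, Ready G t → (∀ p, p ≠ r → p ≠ q → t.reg p = s.reg p) → t.arr = s.arr →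
      t.reg r = (i : ℕ) → (e.eval t ≠ 0 ↔ P i)) :
    ((flag r q w e).run s).reg q = if ∃ i, P i then w else s.reg q := by
  rw [RAM.run_flag s hq (fun i => ∃ hi : i < n, P ⟨i, hi⟩)]
  · congr 1
    rw [h.size]
    exact propext ⟨fun ⟨_, _, _, h⟩ => ⟨_, h⟩, fun ⟨i, h⟩ => ⟨i, i.2, i.2, h⟩⟩
  · intro i t hi hreg harr hir
    have hi : i < n := by rwa [h.size] at hi
    rw [hP ⟨i, hi⟩ t (h.of_eq (hreg 0 hr.symm hq0.symm) (by rw [harr]) (by rw [harr])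
      (by rw [harr])) hreg harr hir]
    exact ⟨fun H => ⟨hi, H⟩, fun ⟨_, H⟩ => H⟩

/-- If the vertex in register `6` is marked, as told by register `8`, mark its neighbors of the
colors in the registers `5` and `b`. -/
def markNeighbors (b : ℕ) : Cmd :=
  fill 7 5 (andE (.var 8) (andE (adjE 6 7)
    (.plus (eqE (.read 4 (.var 7)) (.var 5)) (eqE (.read 4 (.var 7)) (.var b))))) (.const 1)

/-- One round of the propagation of marks. -/
def markRound (b : ℕ) : Cmd :=
  .iter 6 none (.assign 8 (.read 5 (.var 6)) ;; markNeighbors b)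

open Classical in
theorem Ready.markNeighbors_spec {s : State} (h : Ready G s) {b : ℕ} (hb : 11 ≤ b) {x : Fin n}
    (hx : s.reg 6 = x) (y : Fin n) :
    ((markNeighbors b).run s).arr 5 y =
      if s.reg 8 ≠ 0 ∧ G.Adj x y ∧ (colors n s y = s.reg 5 ∨ colors n s y = s.reg b) then 1
      else s.arr 5 y := by
  refine h.run_fill (by decide) (by decide) (fun y => if s.reg 8 ≠ 0 ∧ G.Adj x y ∧
    (colors n s y = s.reg 5 ∨ colors n s y = s.reg b) then 1 else s.arr 5 y) ?_ y
  intro y t ht hreg harr h7 _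
  have h1 : (andE (.var 8) (andE (adjE 6 7)
      (.plus (eqE (.read 4 (.var 7)) (.var 5)) (eqE (.read 4 (.var 7)) (.var b))))).eval t ≠ 0 ↔
      s.reg 8 ≠ 0 ∧ G.Adj x y ∧ (colors n s y = s.reg 5 ∨ colors n s y = s.reg b) := by
    rw [eval_andE, eval_andE, ht.eval_adjE ((hreg 6 (by decide)).trans hx) h7,
      eval_plus_ne_zero, eval_eqE, eval_eqE]
    simp only [eval_read, eval_var, h7, harr 4 (by decide), hreg 8 (by decide),
      hreg 5 (by decide), hreg b (by omega), colors]
  simp only [← h1, ne_eq, ite_not, eval_const]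

theorem markRound_writesReg {b q : ℕ} (h6 : q ≠ 6) (h7 : q ≠ 7) (h8 : q ≠ 8) :
    (markRound b).writesReg q = false := by
  simp [markRound, markNeighbors, fill, Cmd.writesReg, h6, h7, h8]

theorem markRound_writesArr {b a : ℕ} (h5 : a ≠ 5) : (markRound b).writesArr a = false := by
  simp [markRound, markNeighbors, fill, Cmd.writesArr, h5]

/-- Marks set early in a round are already used later in it, so its exact effect depends on the
order of the vertices. Two bounds suffice: the marks stay within any closed set `S`, and they
advance at least one step. -/
theorem Ready.markRound_spec {s : State} (h : Ready G s) {b : ℕ} (hb : 11 ≤ b) (S : Fin n → Prop)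
    (hS : ∀ y : Fin n, s.arr 5 y ≠ 0 → S y)
    (hS' : ∀ x y, S x → G.Adj x y → (colors n s y = s.reg 5 ∨ colors n s y = s.reg b) → S y) :
    (∀ y : Fin n, ((markRound b).run s).arr 5 y ≠ 0 → S y) ∧
    (∀ y : Fin n, s.arr 5 y ≠ 0 → ((markRound b).run s).arr 5 y ≠ 0) ∧
    ∀ x y : Fin n, s.arr 5 x ≠ 0 → G.Adj x y →
      (colors n s y = s.reg 5 ∨ colors n s y = s.reg b) → ((markRound b).run s).arr 5 y ≠ 0 := by
  obtain ⟨t, hI, hrun, -, -⟩ := Cmd.run_iter (r := 6) (b := none)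
    (c := .assign 8 (.read 5 (.var 6)) ;; markNeighbors b)
    (fun i t => (∀ y : Fin n, t.arr 5 y ≠ 0 → S y) ∧
      (∀ y : Fin n, s.arr 5 y ≠ 0 → t.arr 5 y ≠ 0) ∧
      ∀ x y : Fin n, (x : ℕ) < i → s.arr 5 x ≠ 0 → G.Adj x y →
      (colors n s y = s.reg 5 ∨ colors n s y = s.reg b) → t.arr 5 y ≠ 0) s
    ⟨hS, fun _ h => h, by simp⟩ (by
      rintro i t hi hreg harr ⟨hI1, hI2, hI3⟩
      have hi : i < n := by simpa [rounds, h.size] using hi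
      have hreg' : ∀ q, q ≠ 6 → q ≠ 7 → q ≠ 8 → t.reg q = s.reg q := fun q h6 h7 h8 =>
        hreg q h6 (by simp [markNeighbors, fill, Cmd.writesReg, h7, h8])
      have hrd : Ready G ((t.set 6 i).set 8 (t.arr 5 i)) :=
        h.of_eq (by simp [hreg' 0]) (by simpa using harr 0 rfl) (by simpa using harr 2 rfl)
          (by simpa using harr 3 rfl)
      have key := hrd.markNeighbors_spec hb (x := ⟨i, hi⟩) (by simp)
      have hcol : colors n ((t.set 6 i).set 8 (t.arr 5 i)) = colors n s :=
        colors_congr (by simpa using harr 4 rfl)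
      simp only [hcol, State.set_reg, State.set_arr, if_true,
        if_neg (show (5 : ℕ) ≠ 8 by decide), if_neg (show (5 : ℕ) ≠ 6 by decide),
        if_neg (show b ≠ 8 by omega), if_neg (show b ≠ 6 by omega), hreg' 5 (by decide) (by decide)
        (by decide), hreg' b (by omega) (by omega) (by omega)] at key
      simp only [Cmd.run_seq, Cmd.run_assign, eval_read, eval_var, State.set_reg, State.set_arr,
        if_true, key]
      refine ⟨fun y hy => ?_, fun y hy => ?_, fun x y hx hmx hxy hc => ?_⟩
      · split_ifs at hy with hc
        · exact hS' _ _ (hI1 _ hc.1) hc.2.1 hc.2.2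
        · exact hI1 y hy
      · split_ifs with hc
        · exact one_ne_zero
        · exact hI2 y hy
      · split_ifs with hcc
        · exact one_ne_zero
        · rcases Nat.lt_succ_iff_lt_or_eq.1 hx with hlt | rfl
          · exact hI3 x y hlt hmx hxy hc
          · exact absurd ⟨hI2 x hmx, hxy, hc⟩ hcc)
  rw [markRound, hrun]
  refine ⟨hI.1, hI.2.1, fun x y => hI.2.2 x y ?_⟩
  simp [rounds, h.size]

/-- Mark the component of the vertex in register `u` in the subgraph of its color and the color in
register `b`. -/
def markComponent (u b : ℕ) : Cmd :=
  .assign 5 (.read 4 (.var u)) ;;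
  fill 6 5 (.const 1) (.const 0) ;;
  .store 5 (.var u) (.const 1) ;;
  .iter 10 none (markRound b)

theorem markComponent_writesReg {u b q : ℕ} (h5 : q ≠ 5) (h6 : q ≠ 6) (h7 : q ≠ 7) (h8 : q ≠ 8)
    (h10 : q ≠ 10) : (markComponent u b).writesReg q = false := by
  simp [markComponent, fill, Cmd.writesReg, markRound_writesReg, h5, h6, h7, h8, h10]

theorem markComponent_writesArr {u b a : ℕ} (h5 : a ≠ 5) :
    (markComponent u b).writesArr a = false := by
  simp [markComponent, fill, Cmd.writesArr, markRound_writesArr, h5]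

theorem Ready.markComponent_spec {s : State} (h : Ready G s) {u b : ℕ} (hu : 11 ≤ u) (hb : 11 ≤ b)
    {x : Fin n} (hx : s.reg u = x) :
    ((markComponent u b).run s).reg 5 = colors n s x ∧
    ∀ y : Fin n, ((markComponent u b).run s).arr 5 y ≠ 0 ↔
      (Kempe.chain G (colors n s) (colors n s x) (s.reg b)).Reachable x y := by
  set c := colors n s with hc
  set K := Kempe.chain G c (c x) (s.reg b) with hK
  rw [markComponent, Cmd.run_seq, Cmd.run_seq, Cmd.run_seq, Cmd.run_assign, eval_read, eval_var, hx]
  set s₁ := s.set 5 (s.arr 4 x) with hs₁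
  have h₁ : Ready G s₁ := h.of_eq (by simp [hs₁]) rfl rfl rfl
  have hclear : ∀ y : Fin n, ((fill 6 5 (.const 1) (.const 0)).run s₁).arr 5 y = 0 :=
    h₁.run_fill (by decide) (by decide) (fun _ => 0) (by intros; simp)
  have hreg₂ : ∀ q, q ≠ 6 → ((fill 6 5 (.const 1) (.const 0)).run s₁).reg q = s₁.reg q :=
    fun q hq => Cmd.run_reg (by simp [fill, Cmd.writesReg, hq]) _
  have harr₂ : ∀ a, a ≠ 5 → ((fill 6 5 (.const 1) (.const 0)).run s₁).arr a = s₁.arr a :=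
    fun a ha => Cmd.run_arr (by simp [fill, Cmd.writesArr, ha]) _
  generalize (fill 6 5 (.const 1) (.const 0)).run s₁ = s₂ at *
  have hu₂ : s₂.reg u = x := by
    rw [hreg₂ u (by omega), hs₁, State.set_reg, if_neg (by omega), hx]
  rw [Cmd.run_store, eval_var, eval_const, hu₂]
  have hcol : ∀ t : State, t.arr 4 = s.arr 4 → colors n t = c := fun t ht => colors_congr ht
  have hreach : ∀ p q, K.Reachable x p → G.Adj p q → (c q = c x ∨ c q = s.reg b) →
      K.Reachable x q := by
    intro p q hp hpq hq
    have ha : K.Adj p q := ⟨hpq, Kempe.chain_color (.inl rfl) hp, hq⟩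
    exact hp.trans ha.reachable
  obtain ⟨t, hI, hrun, hregt, -⟩ := Cmd.run_iter (r := 10) (b := none) (c := markRound b)
    (fun i t => (∀ y : Fin n, t.arr 5 y ≠ 0 → K.Reachable x y) ∧
      ∀ (y : Fin n) (w : K.Walk y x), w.length ≤ i → t.arr 5 y ≠ 0) (s₂.put 5 x 1)
    (by
      constructor
      · intro y hy
        by_cases hyx : y = x
        · rw [hyx]
        · have : (y : ℕ) ≠ x := fun h => hyx (Fin.ext h)
          simp [this, hclear y] at hy
      · intro y w hw
        have := SimpleGraph.Walk.eq_of_length_eq_zero (Nat.le_zero.1 hw)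
        simp [this])
    (by
      rintro i t hi hreg harr ⟨hI1, hI2⟩
      have hreg' : ∀ q, q ≠ 6 → q ≠ 7 → q ≠ 8 → q ≠ 10 → t.reg q = s₁.reg q :=
        fun q h6 h7 h8 h10 => by
          rw [hreg q h10 (markRound_writesReg h6 h7 h8), State.put_reg, hreg₂ q h6]
      have harr' : ∀ a, a ≠ 5 → t.arr a = s.arr a := fun a ha => by
        rw [harr a (markRound_writesArr ha), State.put_arr_of_ne _ _ _ ha, harr₂ a ha, hs₁]
        rfl
      have hrd : Ready G (t.set 10 i) := h₁.of_eq (by simp [hreg' 0]) (harr' 0 (by decide))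
        (harr' 2 (by decide)) (harr' 3 (by decide))
      have hct : colors n (t.set 10 i) = c := hcol _ (harr' 4 (by decide))
      have hr5 : (t.set 10 i).reg 5 = c x := by
        simp [hreg' 5, hs₁, hc, colors]
      have hrb : (t.set 10 i).reg b = s.reg b := by
        rw [State.set_reg, if_neg (by omega), hreg' b (by omega) (by omega) (by omega) (by omega),
          hs₁, State.set_reg, if_neg (by omega)]
      obtain ⟨k1, k2, k3⟩ := hrd.markRound_spec hb (fun y => K.Reachable x y) hI1
        (by rw [hct, hr5, hrb]; exact hreach)
      rw [hct, hr5, hrb] at k3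
      refine ⟨k1, fun y w hw => ?_⟩
      cases w with
      | nil => exact k2 _ (hI2 _ .nil (by simp))
      | cons hadj w' =>
        exact k3 _ _ (hI2 _ w' (by simpa using hw)) hadj.1.symm hadj.2.1)
  rw [hrun]
  constructor
  · rw [State.set_reg, if_neg (by decide), hregt 5 (by decide) (markRound_writesReg (by decide)
      (by decide) (by decide)), State.put_reg, hreg₂ 5 (by decide)]
    simp [hs₁, hc, colors]
  · intro y
    refine ⟨hI.1 y, fun hr => ?_⟩
    -- A path has length less than `n`, so `n` rounds reach the whole component.
    obtain ⟨w, hw⟩ := hr.symm.exists_isPath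
    refine hI.2 y w ?_
    have := hw.length_lt
    rw [Fintype.card_fin] at this
    have e : rounds (s₂.put 5 x 1) none = n := by
      rw [rounds, State.put_reg, hreg₂ 0 (by decide), h₁.size]
    omega

/-- Exchange the colors on the component of the vertex in register `u` in the subgraph of its color
and the color in register `b`, if the vertex is colored and the degrees in the component are less
than `d`. -/
def swapColors (d u b : ℕ) : Cmd :=
  markComponent u b ;;
  .assign 9 (.var 5) ;;
  flag 6 9 0 (andE (.read 5 (.var 6)) (.minus (.plus (.read 3 (.var 6)) (.const 1)) (.const d))) ;;
  fill 6 4 (andE (.var 9) (.read 5 (.var 6))) (.minus (.plus (.var 5) (.var b)) (.read 4 (.var 6)))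

theorem swapColors_writesReg {d u b q : ℕ} (hq : q = 0 ∨ 11 ≤ q) :
    (swapColors d u b).writesReg q = false := by
  simp [swapColors, flag, fill, Cmd.writesReg, markComponent_writesReg (u := u) (b := b)
    (show q ≠ 5 by omega) (show q ≠ 6 by omega) (show q ≠ 7 by omega) (show q ≠ 8 by omega)
    (show q ≠ 10 by omega), show q ≠ 6 by omega, show q ≠ 9 by omega]

theorem swapColors_writesArr {d u b a : ℕ} (h4 : a ≠ 4) (h5 : a ≠ 5) :
    (swapColors d u b).writesArr a = false := by
  simp [swapColors, flag, fill, Cmd.writesArr, markComponent_writesArr, h4, h5]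

theorem Ready.swapColors_spec {s : State} (h : Ready G s) (d : ℕ) {u b : ℕ} (hu : 11 ≤ u)
    (hb : 11 ≤ b) {x : Fin n} (hx : s.reg u = x) :
    colors n ((swapColors d u b).run s) = Kempe.swap G d (colors n s) x (s.reg b) := by
  classical
  obtain ⟨h5, hmark⟩ := h.markComponent_spec hu hb hx
  have h₁ : Ready G ((markComponent u b).run s) := h.run
    (markComponent_writesReg (by decide) (by decide) (by decide) (by decide) (by decide))
    (markComponent_writesArr (by decide)) (markComponent_writesArr (by decide))
    (markComponent_writesArr (by decide))
  have hb₁ : ((markComponent u b).run s).reg b = s.reg b := Cmd.run_reg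
    (markComponent_writesReg (by omega) (by omega) (by omega) (by omega) (by omega)) s
  have hc₁ : colors n ((markComponent u b).run s) = colors n s :=
    colors_congr (Cmd.run_arr (markComponent_writesArr (by decide)) s)
  rw [swapColors, Cmd.run_seq, Cmd.run_seq, Cmd.run_seq, Cmd.run_assign, eval_var]
  generalize (markComponent u b).run s = s₁ at *
  have h₂ : Ready G (s₁.set 9 (s₁.reg 5)) := h₁.of_eq (by simp) rfl rfl rfl
  have hfl := h₂.run_flag (r := 6) (q := 9) (w := 0) (e := andE (.read 5 (.var 6))
    (.minus (.plus (.read 3 (.var 6)) (.const 1)) (.const d))) (by decide) (by decide) (by decide)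
    (fun y => (Kempe.chain G (colors n s) (colors n s x) (s.reg b)).Reachable x y ∧
      d ≤ G.degree y) (by
      intro y t ht hreg harr h6
      rw [eval_andE, ← hmark]
      simp only [eval_minus, eval_plus, eval_read, eval_var, eval_const, h6, ht.deg, harr,
        State.set_arr]
      have : G.degree y + 1 - d ≠ 0 ↔ d ≤ G.degree y := by omega
      rw [this])
  have hreg₃ : ∀ q, q ≠ 6 → q ≠ 9 → ((flag 6 9 0 (andE (.read 5 (.var 6))
      (.minus (.plus (.read 3 (.var 6)) (.const 1)) (.const d)))).run
      (s₁.set 9 (s₁.reg 5))).reg q = s₁.reg q := fun q h6 h9 => by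
    rw [Cmd.run_reg (by simp [flag, Cmd.writesReg, h6, h9]), State.set_reg, if_neg h9]
  have harr₃ : ((flag 6 9 0 (andE (.read 5 (.var 6))
      (.minus (.plus (.read 3 (.var 6)) (.const 1)) (.const d)))).run
      (s₁.set 9 (s₁.reg 5))).arr = s₁.arr := funext fun a => Cmd.run_arr rfl _
  generalize ((flag 6 9 0 (andE (.read 5 (.var 6))
      (.minus (.plus (.read 3 (.var 6)) (.const 1)) (.const d)))).run
      (s₁.set 9 (s₁.reg 5))) = s₃ at *
  have h₃ : Ready G s₃ := h₁.of_eq (hreg₃ 0 (by decide) (by decide)) (by rw [harr₃])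
    (by rw [harr₃]) (by rw [harr₃])
  funext y
  refine h₃.run_fill (by decide) (by decide)
    (fun y => Kempe.swap G d (colors n s) x (s.reg b) y) ?_ y
  intro y t ht hreg harr h6 h4
  have hcy : s₃.arr 4 y = colors n s y := by rw [harr₃, ← hc₁]; rfl
  -- Register `9` starts as the color of `x` and is reset to `0` if the component has a vertex of
  -- degree at least `d`. So it is nonzero exactly if the exchange is permitted.
  have hg : (andE (.var 9) (.read 5 (.var 6))).eval t ≠ 0 ↔ colors n s x ≠ 0 ∧
      (∀ z, (Kempe.chain G (colors n s) (colors n s x) (s.reg b)).Reachable x z →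
        G.degree z < d) ∧
      (Kempe.chain G (colors n s) (colors n s x) (s.reg b)).Reachable x y := by
    rw [eval_andE, ← hmark]
    simp only [eval_var, eval_read, h6, harr 5 (by decide), harr₃, hreg 9 (by decide), hfl,
      State.set_reg, if_true, h5]
    rw [← and_assoc]
    refine and_congr_left fun _ => ?_
    split_ifs with hex
    · obtain ⟨z, hz, hdz⟩ := hex
      simp only [ne_eq, not_true_eq_false, false_iff, not_and, not_forall]
      exact fun _ => ⟨z, hz, by omega⟩
    · push Not at hex
      exact ⟨fun H => ⟨H, hex⟩, fun H => H.1⟩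
  have he : (Expr.minus (.plus (.var 5) (.var b)) (.read 4 (.var 6))).eval t =
      colors n s x + s.reg b - colors n s y := by
    simp only [eval_minus, eval_plus, eval_var, eval_read, h6, h4, hcy, hreg 5 (by decide),
      hreg b (by omega), hreg₃ 5 (by decide) (by decide), hreg₃ b (by omega) (by omega), h5, hb₁]
  rw [he, hcy, Kempe.swap]
  simp only [← hg, ne_eq, ite_not]

end RAM

/-! ### Exhaustive search for exchanges -/

namespace Kempe

variable {n : ℕ} {G : SimpleGraph (Fin n)} [DecidableRel G.Adj]

variable (G) in
/-- The coloring `c'` arises from `c` by exchanges of colors; expressed by the properties that these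
preserve. -/
def Reaches (k d : ℕ) (c c' : Fin n → ℕ) : Prop :=
  ∀ P : (Fin n → ℕ) → Prop, (∀ c u b, 1 ≤ b → b ≤ k → P c → P (swap G d c u b)) → P c → P c'

theorem Reaches.refl {k d : ℕ} (c : Fin n → ℕ) : Reaches G k d c c := fun _ _ h => h

theorem Reaches.swap_trans {k d : ℕ} {c c' : Fin n → ℕ} {u : Fin n} {b : ℕ} (hb : 1 ≤ b)
    (hbk : b ≤ k) (h : Reaches G k d (swap G d c u b) c') : Reaches G k d c c' :=
  fun P hP hc => h P hP (hP c u b hb hbk hc)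

end Kempe

namespace RAM

theorem IsMinFree.hasFree_iff {n : ℕ} {G : SimpleGraph (Fin n)} {c : Fin n → ℕ} {x : Fin n}
    {f k : ℕ} (h : IsMinFree G c x f) :
    Kempe.HasFree G k x c ↔ f ≤ k := by
  constructor
  · rintro ⟨g, hg, hgk, hfree⟩
    by_contra hcon
    obtain ⟨y, hy, hcy⟩ := h.min g hg (by omega)
    exact hfree y hy hcy
  · exact fun hk => ⟨f, h.one_le, hk, h.free⟩

variable {n : ℕ} {G : SimpleGraph (Fin n)} [DecidableRel G.Adj]

/-- Copy array `b` to array `a`. -/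
def copy (a b : ℕ) : Cmd := fill 6 a (.const 1) (.read b (.var 6))

theorem copy_writesReg {a b q : ℕ} (hq : q ≠ 6) : (copy a b).writesReg q = false := by
  simp [copy, fill, Cmd.writesReg, hq]

theorem copy_writesArr {a b i : ℕ} (hi : i ≠ a) : (copy a b).writesArr i = false := by
  simp [copy, fill, Cmd.writesArr, hi]

theorem Ready.copy_spec {s : State} (h : Ready G s) {a b : ℕ} (ha : 0 ≠ a ∧ 2 ≠ a ∧ 3 ≠ a)
    (hab : b ≠ a) (x : Fin n) : ((copy a b).run s).arr a x = s.arr b x := by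
  refine h.run_fill (by decide) ha (fun x => s.arr b x) ?_ x
  intro i t _ _ harr h6 _
  simp [h6, harr b hab]

/-- A program that changes neither the graph nor the output, nor the registers `11` and from `r` on,
nor the arrays from `a` on. -/
structure Tame (c : Cmd) (r a : ℕ) : Prop where
  reg : ∀ q, q = 0 ∨ q = 11 ∨ r ≤ q → c.writesReg q = false
  arr : ∀ b, b = 0 ∨ b = 1 ∨ b = 2 ∨ b = 3 ∨ a ≤ b → c.writesArr b = false

theorem Ready.run_tame {s : State} (h : Ready G s) {c : Cmd} {r a : ℕ} (hc : Tame c r a) :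
    Ready G (c.run s) :=
  h.run (hc.reg 0 (by simp)) (hc.arr 0 (by simp)) (hc.arr 2 (by simp)) (hc.arr 3 (by simp))

variable (G) in
/-- The program searches for at most `m` exchanges of colors that make a color from `1` to `k` free
at the vertex in register `11`, and leaves the smallest free color in register `1` if successful. -/
def Searches (d k m : ℕ) (c : Cmd) : Prop :=
  ∀ (s : State) (v : Fin n), Ready G s → s.reg 11 = v →
    Kempe.Reaches G k d (colors n s) (colors n (c.run s)) ∧
    ((c.run s).reg 1 ≤ k → Kempe.HasFree G k v (colors n (c.run s))) ∧
    (Kempe.Freeable G k d v m (colors n s) → (c.run s).reg 1 ≤ k)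

theorem minFree_tame : Tame (minFree 11) 12 6 where
  reg q hq := minFree_writesReg (by omega)
  arr _ _ := rfl

theorem minFree_searches (d k : ℕ) : Searches G d k 0 (minFree 11) := by
  intro s v h hv
  have hf := h.minFree_spec (v := 11) (by decide) hv
  rw [colors_congr (n := n) (congrFun (minFree_arr 11 s) 4)]
  exact ⟨.refl _, hf.hasFree_iff.2, hf.hasFree_iff.1⟩

/-- Exchange colors at the vertex in register `r` with the color above the one in register `r + 1`,
and search on; undo the exchange if the search fails. -/
def tryOne (d k : ℕ) (c : Cmd) (r a : ℕ) : Cmd :=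
  copy a 4 ;;
  .assign (r + 2) (.plus (.var (r + 1)) (.const 1)) ;;
  swapColors d r (r + 2) ;;
  c ;;
  .cond (.minus (.var 1) (.const k)) (copy 4 a) .skip

/-- A search with one more exchange. -/
def deepen (d k : ℕ) (c : Cmd) (r a : ℕ) : Cmd :=
  minFree 11 ;;
  .iter r none (.iter (r + 1) (some k)
    (.cond (.minus (.var 1) (.const k)) (tryOne d k c r a) .skip))

section deepen

variable {c : Cmd} {r a : ℕ} {d k m : ℕ}

theorem tryOne_writesReg (hr : 12 ≤ r) (hc : Tame c r a) {q : ℕ}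
    (hq : q = 0 ∨ q = 11 ∨ r ≤ q) (hq2 : q ≠ r + 2) : (tryOne d k c r a).writesReg q = false := by
  have h6 : q ≠ 6 := by omega
  simp [tryOne, Cmd.writesReg, copy_writesReg h6, hq2, hc.reg q hq,
    swapColors_writesReg (show q = 0 ∨ 11 ≤ q by omega)]

theorem tryOne_writesArr (ha : 6 ≤ a) (hc : Tame c r a) {b : ℕ}
    (hb : b = 0 ∨ b = 1 ∨ b = 2 ∨ b = 3 ∨ a + 1 ≤ b) : (tryOne d k c r a).writesArr b = false := by
  simp [tryOne, Cmd.writesArr, copy_writesArr (show b ≠ a by omega),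
    copy_writesArr (show b ≠ 4 by omega), hc.arr b (by omega),
    swapColors_writesArr (show b ≠ 4 by omega) (show b ≠ 5 by omega)]

theorem deepen_tame (hr : 12 ≤ r) (ha : 6 ≤ a) (hc : Tame c r a) :
    Tame (deepen d k c r a) (r + 3) (a + 1) where
  reg q hq := by
    simp [deepen, Cmd.writesReg, minFree_writesReg (show q = 0 ∨ 5 ≤ q by omega),
      tryOne_writesReg hr hc (show q = 0 ∨ q = 11 ∨ r ≤ q by omega) (by omega),
      show q ≠ r by omega, show q ≠ r + 1 by omega]
  arr b hb := by
    simp [deepen, Cmd.writesArr, tryOne_writesArr ha hc hb, minFree, scan, flag]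

/-- Array `a` belongs to this level: neither the exchange nor the inner search `c` changes it. So
the old coloring can be restored after a failure, which shows as a value above `k` in register `1`.
-/
theorem tryOne_spec (hr : 12 ≤ r) (ha : 6 ≤ a) (hc : Tame c r a) (hs : Searches G d k m c)
    {s : State} (h : Ready G s) {v u : Fin n} {j : ℕ} (hv : s.reg 11 = v) (hu : s.reg r = u)
    (hj : s.reg (r + 1) = j) (hjk : j < k) :
    (((tryOne d k c r a).run s).reg 1 ≤ k ∧
      Kempe.HasFree G k v (colors n ((tryOne d k c r a).run s)) ∧
      Kempe.Reaches G k d (colors n s) (colors n ((tryOne d k c r a).run s))) ∨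
    (k < ((tryOne d k c r a).run s).reg 1 ∧ colors n ((tryOne d k c r a).run s) = colors n s ∧
      ¬ Kempe.Freeable G k d v m (Kempe.swap G d (colors n s) u (j + 1))) := by
  have h₁ : Ready G ((copy a 4).run s) := h.run (copy_writesReg (by decide))
    (copy_writesArr (by omega)) (copy_writesArr (by omega)) (copy_writesArr (by omega))
  have hsave := h.copy_spec (a := a) (b := 4) (by omega) (by omega)
  have hcol₁ : colors n ((copy a 4).run s) = colors n s :=
    colors_congr (Cmd.run_arr (copy_writesArr (by omega)) s)
  have hreg₁ : ∀ q, q ≠ 6 → ((copy a 4).run s).reg q = s.reg q :=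
    fun q hq => Cmd.run_reg (copy_writesReg hq) s
  simp only [tryOne, Cmd.run_seq, Cmd.run_assign, eval_plus, eval_var, eval_const,
    hreg₁ (r + 1) (by omega), hj]
  generalize (copy a 4).run s = s₁ at *
  have h₂ : Ready G (s₁.set (r + 2) (j + 1)) := h₁.of_eq (by simp) rfl rfl rfl
  have hcol₃ := h₂.swapColors_spec d (u := r) (b := r + 2) (x := u) (by omega) (by omega)
    (by simp [hreg₁ r (by omega), hu])
  have e : colors n (s₁.set (r + 2) (j + 1)) = colors n s₁ := rfl
  rw [State.set_reg, if_pos rfl, e, hcol₁] at hcol₃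
  have h₃ : Ready G ((swapColors d r (r + 2)).run (s₁.set (r + 2) (j + 1))) :=
    h₂.run (swapColors_writesReg (by decide)) (swapColors_writesArr (by decide) (by decide))
      (swapColors_writesArr (by decide) (by decide)) (swapColors_writesArr (by decide) (by decide))
  have hv₃ : ((swapColors d r (r + 2)).run (s₁.set (r + 2) (j + 1))).reg 11 = v := by
    rw [Cmd.run_reg (swapColors_writesReg (by decide)), State.set_reg, if_neg (by omega),
      hreg₁ 11 (by decide), hv]
  have ha₃ : ((swapColors d r (r + 2)).run (s₁.set (r + 2) (j + 1))).arr a = s₁.arr a := by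
    rw [Cmd.run_arr (swapColors_writesArr (by omega) (by omega)), State.set_arr]
  generalize (swapColors d r (r + 2)).run (s₁.set (r + 2) (j + 1)) = s₃ at *
  obtain ⟨hreach, hfree, hfreeable⟩ := hs s₃ v h₃ hv₃
  have h₄ := h₃.run_tame hc
  have ha₄ : (c.run s₃).arr a = s₁.arr a := by rw [Cmd.run_arr (hc.arr a (by omega)), ha₃]
  generalize c.run s₃ = s₄ at *
  rw [hcol₃] at hreach hfreeable
  by_cases hk : s₄.reg 1 ≤ k
  · left
    rw [Cmd.run_cond, if_pos (by simp only [eval_minus, eval_var, eval_const]; omega), Cmd.run_skip]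
    exact ⟨hk, hfree hk, hreach.swap_trans (by omega) (by omega)⟩
  · right
    rw [Cmd.run_cond, if_neg (by simp; omega), Cmd.run_reg (copy_writesReg (by decide))]
    refine ⟨by omega, ?_, mt hfreeable hk⟩
    funext x
    rw [colors, h₄.copy_spec (by decide) (by omega), ha₄, hsave]
    rfl

theorem deepen_searches (hr : 12 ≤ r) (ha : 6 ≤ a) (hc : Tame c r a) (hs : Searches G d k m c) :
    Searches G d k (m + 1) (deepen d k c r a) := by
  intro s v h hv
  have hmin := h.minFree_spec (v := 11) (by decide) hv
  have h₁ := h.run_tame minFree_tame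
  have hv₁ : ((minFree 11).run s).reg 11 = v := by
    rw [Cmd.run_reg (minFree_tame.reg 11 (by simp)), hv]
  have hcol₁ : colors n ((minFree 11).run s) = colors n s :=
    colors_congr (congrFun (minFree_arr 11 s) 4)
  rw [deepen, Cmd.run_seq]
  generalize (minFree 11).run s = s₁ at *
  set c₀ := colors n s with hc₀
  -- Either a color has been made free, and the remaining rounds do nothing, or the original
  -- coloring is in place and `Q` lists the exchanges already ruled out.
  let Inv (Q : Prop) (t : State) : Prop :=
    (t.reg 1 ≤ k ∧ Kempe.HasFree G k v (colors n t) ∧ Kempe.Reaches G k d c₀ (colors n t)) ∨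
      (k < t.reg 1 ∧ colors n t = c₀ ∧ Q)
  have hframe : ∀ t : State, (∀ q, (q = 0 ∨ q = 11) → t.reg q = s₁.reg q) →
      (∀ b, b = 0 ∨ b = 2 ∨ b = 3 → t.arr b = s₁.arr b) → Ready G t ∧ t.reg 11 = v :=
    fun t hreg harr => ⟨h₁.of_eq (hreg 0 (.inl rfl)) (harr 0 (.inl rfl)) (harr 2 (by simp))
      (harr 3 (by simp)), (hreg 11 (.inr rfl)).trans hv₁⟩
  obtain ⟨t, hI, hrun, -, -⟩ := Cmd.run_iter (r := r) (b := none)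
    (c := .iter (r + 1) (some k) (.cond (.minus (.var 1) (.const k)) (tryOne d k c r a) .skip))
    (fun i t => Inv (¬ Kempe.HasFree G k v c₀ ∧ ∀ u : Fin n, (u : ℕ) < i → ∀ b, 1 ≤ b → b ≤ k →
      ¬ Kempe.Freeable G k d v m (Kempe.swap G d c₀ u b)) t) s₁
    (by
      by_cases hk : s₁.reg 1 ≤ k
      · exact .inl ⟨hk, hcol₁ ▸ hmin.hasFree_iff.2 hk, hcol₁ ▸ .refl _⟩
      · exact .inr ⟨by omega, hcol₁, mt hmin.hasFree_iff.1 hk, by simp⟩)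
    (by
      intro i t hi hreg harr hI
      have hi : i < n := by simpa [rounds, h₁.size] using hi
      have hreg' : ∀ q, q = 0 ∨ q = 11 → t.reg q = s₁.reg q := fun q hq =>
        hreg q (by omega) (by
          simp [Cmd.writesReg, tryOne_writesReg hr hc (show q = 0 ∨ q = 11 ∨ r ≤ q by omega)
            (by omega), show q ≠ r + 1 by omega])
      have harr' : ∀ b, b = 0 ∨ b = 2 ∨ b = 3 → t.arr b = s₁.arr b := fun b hb =>
        harr b (by
          simp [Cmd.writesArr, tryOne_writesArr ha hc
            (show b = 0 ∨ b = 1 ∨ b = 2 ∨ b = 3 ∨ a + 1 ≤ b by omega)])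
      obtain ⟨t', hI', hrun', -, -⟩ := Cmd.run_iter (r := r + 1) (b := some k)
        (c := .cond (.minus (.var 1) (.const k)) (tryOne d k c r a) .skip)
        (fun j t => Inv (¬ Kempe.HasFree G k v c₀ ∧ (∀ u : Fin n, (u : ℕ) < i → ∀ b, 1 ≤ b →
          b ≤ k → ¬ Kempe.Freeable G k d v m (Kempe.swap G d c₀ u b)) ∧
          ∀ b, 1 ≤ b → b ≤ j →
            ¬ Kempe.Freeable G k d v m (Kempe.swap G d c₀ ⟨i, hi⟩ b)) t) (t.set r i)
        (by
          have e : (t.set r i).reg 1 = t.reg 1 := by rw [State.set_reg, if_neg (by omega)]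
          rcases hI with hI | ⟨h1, h2, h3, h4⟩
          · exact .inl ⟨e ▸ hI.1, hI.2⟩
          · exact .inr ⟨e ▸ h1, h2, h3, h4, fun b hb hb0 => by omega⟩)
        (by
          intro j p hj hregp harrp hJ
          have hj : j < k := hj
          have hregp' : ∀ q, q = 0 ∨ q = 11 ∨ q = r → p.reg q = (t.set r i).reg q := fun q hq =>
            hregp q (by omega) (by
              simp [Cmd.writesReg, tryOne_writesReg hr hc (show q = 0 ∨ q = 11 ∨ r ≤ q by omega)
                (show q ≠ r + 2 by omega)])
          have harrp' : ∀ b, b = 0 ∨ b = 2 ∨ b = 3 → p.arr b = t.arr b := fun b hb =>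
            harrp b (by
              simp [Cmd.writesArr, tryOne_writesArr ha hc
                (show b = 0 ∨ b = 1 ∨ b = 2 ∨ b = 3 ∨ a + 1 ≤ b by omega)])
          obtain ⟨hrd, hvp⟩ := hframe (p.set (r + 1) j) (fun q hq => by
            rw [State.set_reg, if_neg (by omega), hregp' q (by omega), State.set_reg,
              if_neg (by omega), hreg' q hq])
            (fun b hb => by rw [State.set_arr, harrp' b hb, harr' b hb])
          have e : (p.set (r + 1) j).reg 1 = p.reg 1 := by rw [State.set_reg, if_neg (by omega)]
          rw [Cmd.run_cond]
          rcases hJ with hJ | ⟨h1, h2, h3, h4, h5⟩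
          · rw [if_pos (by
              have := hJ.1
              simp only [eval_minus, eval_var, eval_const, e]
              omega), Cmd.run_skip]
            exact .inl ⟨e ▸ hJ.1, hJ.2⟩
          · rw [if_neg (by simp only [eval_minus, eval_var, eval_const, e]; omega)]
            have h2' : colors n (p.set (r + 1) j) = c₀ := h2
            have htry := tryOne_spec (u := ⟨i, hi⟩) hr ha hc hs hrd hvp (by
              rw [State.set_reg, if_neg (by omega), hregp' r (by simp)]; simp) (by simp) hj
            rw [h2'] at htry
            rcases htry with H | ⟨H1, H2, H3⟩
            · exact .inl H
            · refine .inr ⟨H1, H2, h3, h4, fun b hb hbj => ?_⟩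
              rcases hbj.lt_or_eq with hlt | rfl
              · exact h5 b hb (by omega)
              · exact H3)
      rw [hrun']
      have e : (t'.set (r + 1) (rounds (t.set r i) (some k))).reg 1 = t'.reg 1 := by
        rw [State.set_reg, if_neg (by omega)]
      rcases hI' with hJ | ⟨h1, h2, h3, h4, h5⟩
      · exact .inl ⟨e ▸ hJ.1, hJ.2⟩
      · refine .inr ⟨e ▸ h1, h2, h3, fun u hu => ?_⟩
        rcases Nat.lt_succ_iff_lt_or_eq.1 hu with hlt | rfl
        · exact h4 u hlt
        · exact h5)
  rw [hrun, State.set_reg, if_neg (by omega)]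
  have e : colors n (t.set r (rounds s₁ none)) = colors n t := rfl
  rw [e]
  rcases hI with ⟨h1, h2, h3⟩ | ⟨h1, h2, h3, h4⟩
  · exact ⟨h3, fun _ => h2, fun _ => h1⟩
  · refine ⟨h2 ▸ .refl _, fun hk => by omega, ?_⟩
    rintro (hf | ⟨u, b, hb, hbk, hf⟩)
    · exact absurd hf h3
    · exact absurd hf (h4 u (by simp [rounds, h₁.size]) b hb hbk)

end deepen

/-- The search with at most three exchanges. -/
def search (d k : ℕ) : Cmd :=
  -- Each level has three registers of its own, for the vertex, the loop over colors and the color,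
  -- and one array for the saved coloring.
  deepen d k (deepen d k (deepen d k (minFree 11) 12 6) 15 7) 18 8

theorem search_tame (d k : ℕ) : Tame (search d k) 21 9 :=
  deepen_tame (by decide) (by decide) (deepen_tame (by decide) (by decide)
    (deepen_tame (by decide) (by decide) minFree_tame))

theorem search_searches (d k : ℕ) : Searches G d k 3 (search d k) :=
  deepen_searches (by decide) (by decide) (deepen_tame (by decide) (by decide)
    (deepen_tame (by decide) (by decide) minFree_tame))
    (deepen_searches (by decide) (by decide) (deepen_tame (by decide) (by decide) minFree_tame)
      (deepen_searches (by decide) (by decide) minFree_tame (minFree_searches d k)))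

end RAM

/-! ### Precolorings of the vertices of large degree -/

namespace Kempe

variable {n : ℕ} {G : SimpleGraph (Fin n)}

theorem PartialProper.update {c : Fin n → ℕ} (h : PartialProper G c) {v : Fin n} {f : ℕ}
    (hv : c v = 0) (hf : ∀ y, G.Adj v y → c y ≠ f) :
    PartialProper G (Function.update c v f) := by
  intro x y hxy h0
  by_cases hx : x = v
  · subst hx
    rw [Function.update_self, Function.update_of_ne hxy.ne']
    exact (hf y hxy).symm
  · rw [Function.update_of_ne hx] at h0 ⊢
    by_cases hy : y = v
    · subst hy
      rw [Function.update_self]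
      exact hf x hxy.symm
    · rw [Function.update_of_ne hy]
      exact h x y hxy h0

variable [DecidableRel G.Adj]

variable (G) in
/-- A proper two-coloring of the vertices of degree at least `d`. -/
def Bicoloring (d : ℕ) (f : Fin n → Bool) : Prop :=
  ∀ x y, G.Adj x y → d ≤ G.degree x → d ≤ G.degree y → f x ≠ f y

variable (G) in
/-- A partial coloring of the vertices of degree at least `d` that uses two colors if possible, and
one color if these vertices are pairwise not adjacent. -/
structure Precoloring (d : ℕ) (c : Fin n → ℕ) : Prop where
  proper : PartialProper G c
  degree : ∀ x, c x ≠ 0 → d ≤ G.degree x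
  -- Conditional, like `one`, because all pairs `(d, k)` are tried on every graph, whether or not
  -- the large-degree vertices induce a bipartite graph.
  two : ∀ f, Bicoloring G d f → ∃ f, Bicoloring G d f ∧ ∀ x, c x ≠ 0 → c x = if f x then 2 else 1
  one : (∀ x y, G.Adj x y → d ≤ G.degree x → ¬ d ≤ G.degree y) → ∀ x, c x ≤ 1

theorem Precoloring.zero (d : ℕ) : Precoloring G d (fun _ => 0) where
  proper _ _ _ h := absurd rfl h
  degree _ h := absurd rfl h
  two f hf := ⟨f, hf, fun _ h => absurd rfl h⟩
  one _ _ := by simp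

/-- Coloring a vertex with its smallest free color extends a precoloring, if the vertex has a
colored neighbor or no uncolored vertex of degree at least `d` has. -/
theorem Precoloring.update {d : ℕ} {c : Fin n → ℕ} (h : Precoloring G d c) {v : Fin n} {f : ℕ}
    (hv : c v = 0) (hd : d ≤ G.degree v)
    (ht : (∃ y, G.Adj v y ∧ c y ≠ 0) ∨
      ∀ x, c x = 0 → d ≤ G.degree x → ¬ ∃ y, G.Adj x y ∧ c y ≠ 0)
    (hf : RAM.IsMinFree G c v f) : Precoloring G d (Function.update c v f) where
  proper := h.proper.update hv hf.free
  degree x hx := by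
    by_cases hxv : x = v
    · rwa [hxv]
    · rw [Function.update_of_ne hxv] at hx
      exact h.degree x hx
  one hst x := by
    by_cases hxv : x = v
    · rw [hxv, Function.update_self]
      by_contra hcon
      obtain ⟨y, hy, hcy⟩ := hf.min 1 le_rfl (by omega)
      exact hst v y hy hd (h.degree y (by omega))
    · rw [Function.update_of_ne hxv]
      exact h.one hst x
  two g hg := by
    obtain ⟨g, hg, hgc⟩ := h.two g hg
    have extend : ∀ g', Bicoloring G d g' → (∀ x, c x ≠ 0 → g' x = g x) →
        f = (if g' v then 2 else 1) → ∃ f', Bicoloring G d f' ∧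
          ∀ x, Function.update c v f x ≠ 0 → Function.update c v f x = if f' x then 2 else 1 := by
      intro g' hg' heq hfv
      refine ⟨g', hg', fun x hx => ?_⟩
      by_cases hxv : x = v
      · rw [hxv, Function.update_self, hfv]
      · rw [Function.update_of_ne hxv] at hx ⊢
        rw [hgc x hx, heq x hx]
    by_cases hto : ∃ y, G.Adj v y ∧ c y ≠ 0
    · refine extend g hg (fun _ _ => rfl) ?_
      -- All colored neighbors of `v` lie on the other side of the bipartition. As there is one, the
      -- smallest free color is the color of the side of `v`.
      have hnb : ∀ y, G.Adj v y → c y ≠ 0 → c y = if g v then 1 else 2 := by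
        intro y hy hcy
        rw [hgc y hcy]
        have := hg v y hy hd (h.degree y hcy)
        cases hgv : g v <;> cases hgy : g y <;> simp_all
      obtain ⟨y, hy, hcy⟩ := hto
      have hfy := hf.free y hy
      rw [hnb y hy hcy] at hfy
      have h1 := hf.one_le
      cases hgv : g v
      · simp only [hgv] at hfy hnb
        by_contra hcon
        obtain ⟨z, hz, hcz⟩ := hf.min 1 le_rfl (by simp at hcon; omega)
        have := hnb z hz (by omega)
        simp [hcz] at this
      · simp only [hgv] at hfy hnb
        by_contra hcon
        obtain ⟨z, hz, hcz⟩ := hf.min 2 (by omega) (by simp at hcon hfy; omega)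
        have := hnb z hz (by omega)
        simp [hcz] at this
    · have hun := ht.resolve_left hto
      have hf1 : f = 1 := by
        by_contra hcon
        have := hf.one_le
        obtain ⟨y, hy, hcy⟩ := hf.min 1 le_rfl (by omega)
        exact hto ⟨y, hy, by omega⟩
      -- A new component begins. No edge joins a colored to an uncolored vertex of large degree, so
      -- the bipartition may be flipped on all uncolored vertices to give `v` the color `1`.
      refine extend (fun x => if c x = 0 then xor (g x) (g v) else g x) ?_
        (fun x hx => by simp [hx]) (by simp [hv, hf1])
      intro x y hxy hx hy
      have hne := hg x y hxy hx hy
      by_cases h1 : c x = 0 <;> by_cases h2 : c y = 0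
      · simp only [h1, h2, if_true]
        cases hgx : g x <;> cases hgy : g y <;> cases g v <;> simp_all
      · exact absurd ⟨y, hxy, h2⟩ (hun x h1 hx)
      · exact absurd ⟨x, hxy.symm, h1⟩ (hun y h2 hy)
      · simpa [h1, h2] using hne

variable (G) in
/-- Every precoloring uses at most `k` colors and allows to color the other vertices greedily with
`k` colors after exchanges of colors. -/
def Solvable (d k : ℕ) : Prop :=
  ∀ p, Precoloring G d p → (∀ x, d ≤ G.degree x → p x ≠ 0) → (∀ x, p x ≤ k) ∧
    ∀ c, PartialProper G c → (∀ x, c x ≤ k) → (∀ x, d ≤ G.degree x → c x = p x) →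
      ∀ v, c v = 0 → Freeable G k d v 3 c

end Kempe

/-! ### Programs for precoloring and for extending a precoloring -/

namespace RAM

variable {n : ℕ} {G : SimpleGraph (Fin n)} [DecidableRel G.Adj]

/-- Put one more than an uncolored vertex of degree at least `d` into register `13`, one with a
colored neighbor if there is one. -/
def select (d : ℕ) : Cmd :=
  .assign 13 (.const 0) ;;
  .iter 11 none (.cond (andE (eqE (.read 4 (.var 11)) (.const 0))
      (.minus (.plus (.read 3 (.var 11)) (.const 1)) (.const d)))
    (scan 11 (.read 4 (.var 4)) ;;
      .cond (.plus (.var 3) (eqE (.var 13) (.const 0)))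
        (.assign 13 (.plus (.var 11) (.const 1))) .skip)
    .skip)

/-- Color the vertices of degree at least `d`. -/
def precolor (d : ℕ) : Cmd :=
  .iter 12 none (select d ;;
    .cond (.var 13)
      (.assign 11 (.minus (.var 13) (.const 1)) ;; minFree 11 ;; .store 4 (.var 11) (.var 1))
      .skip)

theorem Ready.select_spec {s : State} (h : Ready G s) (d : ℕ) :
    (((select d).run s).reg 13 = 0 ∧ ∀ x, colors n s x = 0 → ¬ d ≤ G.degree x) ∨
    ∃ v : Fin n, ((select d).run s).reg 13 = v + 1 ∧ colors n s v = 0 ∧ d ≤ G.degree v ∧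
      ((∃ y, G.Adj v y ∧ colors n s y ≠ 0) ∨
        ∀ x, colors n s x = 0 → d ≤ G.degree x → ¬ ∃ y, G.Adj x y ∧ colors n s y ≠ 0) := by
  rw [select, Cmd.run_seq, Cmd.run_assign, eval_const]
  obtain ⟨t, hI, hrun, -, -⟩ := Cmd.run_iter (r := 11) (b := none)
    (c := .cond (andE (eqE (.read 4 (.var 11)) (.const 0))
      (.minus (.plus (.read 3 (.var 11)) (.const 1)) (.const d)))
      (scan 11 (.read 4 (.var 4)) ;;
        .cond (.plus (.var 3) (eqE (.var 13) (.const 0)))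
          (.assign 13 (.plus (.var 11) (.const 1))) .skip)
      .skip)
    (fun i t => (t.reg 13 = 0 ∧ ∀ x : Fin n, (x : ℕ) < i → colors n s x = 0 → ¬ d ≤ G.degree x) ∨
      ∃ v : Fin n, t.reg 13 = v + 1 ∧ colors n s v = 0 ∧ d ≤ G.degree v ∧
      ((∃ y, G.Adj v y ∧ colors n s y ≠ 0) ∨ ∀ x : Fin n, (x : ℕ) < i → colors n s x = 0 →
        d ≤ G.degree x → ¬ ∃ y, G.Adj x y ∧ colors n s y ≠ 0)) (s.set 13 0)
    (.inl ⟨by simp, by simp⟩)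
    (by
      intro i t hi hreg harr hI
      have hi : i < n := by simpa [rounds, h.size] using hi
      have harr' : t.arr = s.arr := funext fun a => harr a rfl
      have hrd : Ready G (t.set 11 i) := h.of_eq (by simpa using hreg 0 (by decide) rfl)
        (by simp [harr']) (by simp [harr']) (by simp [harr'])
      have hcond : (andE (eqE (.read 4 (.var 11)) (.const 0))
          (.minus (.plus (.read 3 (.var 11)) (.const 1)) (.const d))).eval (t.set 11 i) ≠ 0 ↔
          colors n s ⟨i, hi⟩ = 0 ∧ d ≤ G.degree ⟨i, hi⟩ := by
        have hdeg := hrd.deg ⟨i, hi⟩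
        rw [State.set_arr] at hdeg
        rw [eval_andE, eval_eqE]
        simp only [eval_read, eval_var, eval_minus, eval_plus, eval_const, State.set_reg,
          State.set_arr, if_true, hdeg]
        rw [harr']
        refine and_congr_right fun _ => ?_
        omega
      rw [Cmd.run_cond]
      by_cases hc : colors n s ⟨i, hi⟩ = 0 ∧ d ≤ G.degree ⟨i, hi⟩
      · rw [if_neg (hcond.2 hc), Cmd.run_seq]
        have hscan := hrd.scan_spec (v := 11) (by decide) (x := ⟨i, hi⟩) (by simp)
          (g := .read 4 (.var 4)) (fun y => colors n s y ≠ 0) (by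
            intro y t' ha hr h4
            simp [h4, ha, harr', colors])
        have h13 : ((scan 11 (.read 4 (.var 4))).run (t.set 11 i)).reg 13 = t.reg 13 := by
          rw [Cmd.run_reg rfl]; simp
        have h11 : ((scan 11 (.read 4 (.var 4))).run (t.set 11 i)).reg 11 = i := by
          rw [Cmd.run_reg rfl]; simp
        generalize (scan 11 (.read 4 (.var 4))).run (t.set 11 i) = t₂ at *
        rw [Cmd.run_cond]
        have hcond₂ : (Expr.plus (.var 3) (eqE (.var 13) (.const 0))).eval t₂ ≠ 0 ↔
            t₂.reg 3 ≠ 0 ∨ t.reg 13 = 0 := by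
          rw [eval_plus_ne_zero, eval_eqE]
          simp [h13]
        by_cases hc₂ : t₂.reg 3 ≠ 0 ∨ t.reg 13 = 0
        · rw [if_neg (hcond₂.2 hc₂), Cmd.run_assign]
          right
          refine ⟨⟨i, hi⟩, by simp [h11], hc.1, hc.2, ?_⟩
          by_cases h3 : t₂.reg 3 ≠ 0
          · exact .inl (hscan.1 h3)
          · right
            intro x hx hcx hdx
            rcases Nat.lt_succ_iff_lt_or_eq.1 hx with hlt | rfl
            · rcases hI with ⟨_, hI⟩ | ⟨v, hI, _⟩
              · exact absurd hdx (hI x hlt hcx)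
              · have := hc₂.resolve_left h3
                omega
            · exact mt hscan.2 h3
        · rw [if_pos (not_not.1 (mt hcond₂.1 hc₂)), Cmd.run_skip]
          push Not at hc₂
          obtain ⟨v, hv, hcv, hdv, hI⟩ := hI.resolve_left fun H => hc₂.2 H.1
          refine .inr ⟨v, h13.trans hv, hcv, hdv, hI.imp_right fun hI x hx hcx hdx => ?_⟩
          rcases Nat.lt_succ_iff_lt_or_eq.1 hx with hlt | rfl
          · exact hI x hlt hcx hdx
          · exact fun H => hscan.2 H hc₂.1
      · rw [if_pos (not_not.1 (mt hcond.1 hc)), Cmd.run_skip]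
        have h13 : (t.set 11 i).reg 13 = t.reg 13 := by simp
        rcases hI with ⟨h1, h2⟩ | ⟨v, hv, hcv, hdv, hI⟩
        · refine .inl ⟨h13.trans h1, fun x hx hcx hdx => ?_⟩
          rcases Nat.lt_succ_iff_lt_or_eq.1 hx with hlt | rfl
          · exact h2 x hlt hcx hdx
          · exact hc ⟨hcx, hdx⟩
        · refine .inr ⟨v, h13.trans hv, hcv, hdv, hI.imp_right fun hI x hx hcx hdx => ?_⟩
          rcases Nat.lt_succ_iff_lt_or_eq.1 hx with hlt | rfl
          · exact hI x hlt hcx hdx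
          · exact absurd ⟨hcx, hdx⟩ hc)
  rw [hrun, State.set_reg, if_neg (by decide)]
  have e : rounds (s.set 13 0) none = n := by simp [rounds, h.size]
  rw [e] at hI
  rcases hI with ⟨h1, h2⟩ | ⟨v, hv, hcv, hdv, hI⟩
  · exact .inl ⟨h1, fun x => h2 x x.2⟩
  · exact .inr ⟨v, hv, hcv, hdv, hI.imp_right fun hI x => hI x x.2⟩

theorem colors_put {s : State} (v : Fin n) (f : ℕ) :
    colors n (s.put 4 v f) = Function.update (colors n s) v f := by
  funext x
  by_cases hx : x = v
  · subst hx; simp [colors]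
  · have : (x : ℕ) ≠ v := fun h => hx (Fin.ext h)
    rw [Function.update_of_ne hx]
    simp [colors, this]

/-- Coloring the vertex in register `11` with its smallest free color. -/
theorem Ready.color_spec {s : State} (h : Ready G s) {v : Fin n} (hv : s.reg 11 = v) :
    ∃ f, IsMinFree G (colors n s) v f ∧
      colors n ((minFree 11 ;; .store 4 (.var 11) (.var 1)).run s) =
        Function.update (colors n s) v f := by
  refine ⟨_, h.minFree_spec (v := 11) (by decide) hv, ?_⟩
  rw [Cmd.run_seq, Cmd.run_store, eval_var, eval_var, Cmd.run_reg (minFree_tame.reg 11 (by simp)),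
    hv, colors_put, colors_congr (congrFun (minFree_arr 11 s) 4)]

theorem Ready.precolor_spec {s : State} (h : Ready G s) (d : ℕ) (h0 : ∀ x, colors n s x = 0) :
    Kempe.Precoloring G d (colors n ((precolor d).run s)) ∧
      ∀ x, d ≤ G.degree x → colors n ((precolor d).run s) x ≠ 0 := by
  obtain ⟨t, hI, hrun, -, -⟩ := Cmd.run_iter (r := 12) (b := none) (c := select d ;;
    .cond (.var 13)
      (.assign 11 (.minus (.var 13) (.const 1)) ;; minFree 11 ;; .store 4 (.var 11) (.var 1))
      .skip)
    -- Each round colors a new vertex unless none is left to color, so counting colored vertices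
    -- shows that `n` rounds suffice.
    (fun i t => Kempe.Precoloring G d (colors n t) ∧
      ((∀ x, d ≤ G.degree x → colors n t x ≠ 0) ∨
        i ≤ (Finset.univ.filter fun x => colors n t x ≠ 0).card)) s
    ⟨by rw [show colors n s = fun _ => 0 from funext h0]; exact .zero d, .inr (Nat.zero_le _)⟩
    (by
      rintro i t hi hreg harr ⟨hI, hI'⟩
      have hrd : Ready G (t.set 12 i) := h.of_eq (by simpa using hreg 0 (by decide) rfl)
        (by simpa using harr 0 rfl) (by simpa using harr 2 rfl) (by simpa using harr 3 rfl)
      have e : colors n (t.set 12 i) = colors n t := rfl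
      have hsel := hrd.select_spec d
      have hrd₂ : Ready G ((select d).run (t.set 12 i)) := hrd.run rfl rfl rfl rfl
      have e₂ : colors n ((select d).run (t.set 12 i)) = colors n t :=
        (colors_congr (Cmd.run_arr rfl _)).trans e
      rw [e] at hsel
      rw [Cmd.run_seq]
      generalize (select d).run (t.set 12 i) = t₂ at *
      rw [Cmd.run_cond]
      rcases hsel with ⟨h13, hall⟩ | ⟨v, h13, hcv, hdv, hto⟩
      · rw [if_pos (show (Expr.var 13).eval t₂ = 0 from h13), Cmd.run_skip, e₂]
        exact ⟨hI, .inl fun x hx hcx => hall x hcx hx⟩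
      · rw [if_neg (by simp [h13]), Cmd.run_seq, Cmd.run_assign]
        have h11 : (Expr.minus (.var 13) (.const 1)).eval t₂ = v := by simp [h13]
        rw [h11]
        have hrd₃ : Ready G (t₂.set 11 v) := hrd₂.of_eq (by simp) rfl rfl rfl
        obtain ⟨f, hf, hcol⟩ := hrd₃.color_spec (v := v) (by simp)
        have e₃ : colors n (t₂.set 11 v) = colors n t := e₂
        rw [e₃] at hf hcol
        rw [hcol]
        refine ⟨hI.update hcv hdv hto hf, .inr ?_⟩
        have hlt : i ≤ (Finset.univ.filter fun x => colors n t x ≠ 0).card :=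
          hI'.resolve_left fun H => H v hdv hcv
        refine lt_of_le_of_lt hlt (Finset.card_lt_card (Finset.ssubset_iff_of_subset ?_ |>.2
          ⟨v, ?_, ?_⟩))
        · intro x hx
          simp only [Finset.mem_filter, Finset.mem_univ, true_and] at hx ⊢
          rw [Function.update_of_ne (by rintro rfl; exact hx hcv)]
          exact hx
        · have := hf.one_le
          simp only [Finset.mem_filter, Finset.mem_univ, true_and, Function.update_self]
          omega
        · simp [hcv])
  rw [precolor, hrun]
  refine ⟨hI.1, hI.2.elim id fun hn x _ hx => ?_⟩
  have e : rounds s none = n := h.size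
  rw [e] at hn
  have hlt := Finset.card_lt_card (Finset.filter_ssubset (s := Finset.univ)
    (p := fun x => colors n t x ≠ 0) |>.2 ⟨x, Finset.mem_univ _, not_not.2 hx⟩)
  rw [Finset.card_univ, Fintype.card_fin] at hlt
  omega

/-- Color the uncolored vertices. -/
def extend (d k : ℕ) : Cmd :=
  .iter 11 none (.cond (.read 4 (.var 11)) .skip
    (search d k ;; minFree 11 ;; .store 4 (.var 11) (.var 1)))

theorem extend_writes (d k : ℕ) : (∀ b, b = 0 ∨ b = 1 ∨ b = 2 ∨ b = 3 →
    (extend d k).writesArr b = false) ∧ (extend d k).writesReg 0 = false := by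
  constructor
  · intro b hb
    simp [extend, Cmd.writesArr, (search_tame d k).arr b (by omega), minFree_tame.arr b (by omega),
      show b ≠ 4 by omega]
  · simp [extend, Cmd.writesReg, (search_tame d k).reg 0 (by simp), minFree_tame.reg 0 (by simp)]

/-- A failed search still ends with the smallest free color, so the result is always a proper
coloring of the whole graph. Only the bound `k` depends on solvability. -/
theorem Ready.extend_spec {s : State} (h : Ready G s) (d k : ℕ)
    (hp : Kempe.Precoloring G d (colors n s)) (hd : ∀ x, d ≤ G.degree x → colors n s x ≠ 0) :
    Kempe.PartialProper G (colors n ((extend d k).run s)) ∧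
      (∀ x, colors n ((extend d k).run s) x ≠ 0) ∧
      (Kempe.Solvable G d k → ∀ x, colors n ((extend d k).run s) x ≤ k) := by
  set p := colors n s with hpdef
  obtain ⟨t, hI, hrun, -, -⟩ := Cmd.run_iter (r := 11) (b := none)
    (c := .cond (.read 4 (.var 11)) .skip
      (search d k ;; minFree 11 ;; .store 4 (.var 11) (.var 1)))
    (fun i t => Kempe.PartialProper G (colors n t) ∧
      (∀ x : Fin n, (x : ℕ) < i → colors n t x ≠ 0) ∧
      (Kempe.Solvable G d k → (∀ x, colors n t x ≤ k) ∧
        ∀ x, d ≤ G.degree x → colors n t x = p x)) s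
    ⟨hp.proper, by simp, fun hsol => ⟨(hsol p hp hd).1, fun _ _ => rfl⟩⟩
    (by
      rintro i t hi hreg harr ⟨hI1, hI2, hI3⟩
      have hi : i < n := by simpa [rounds, h.size] using hi
      have hz := (extend_writes d k)
      have hrd : Ready G (t.set 11 i) := h.of_eq
        (by
          simpa using hreg 0 (by decide) (by
            simp [Cmd.writesReg, (search_tame d k).reg 0 (by simp), minFree_tame.reg 0 (by simp)]))
        (harr 0 (hz.1 0 (by simp))) (harr 2 (hz.1 2 (by simp))) (harr 3 (hz.1 3 (by simp)))
      have e : colors n (t.set 11 i) = colors n t := rfl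
      rw [Cmd.run_cond]
      have hcond : (Expr.read 4 (.var 11)).eval (t.set 11 i) = colors n t ⟨i, hi⟩ := by
        simp [colors]
      rw [hcond]
      by_cases hc : colors n t ⟨i, hi⟩ = 0
      · rw [if_pos hc, Cmd.run_seq]
        obtain ⟨hreach, hfree, hfreeable⟩ := search_searches (G := G) d k (t.set 11 i) ⟨i, hi⟩ hrd
          (by simp)
        have hrd₂ := hrd.run_tame (search_tame d k)
        have h11 : ((search d k).run (t.set 11 i)).reg 11 = i := by
          rw [Cmd.run_reg ((search_tame d k).reg 11 (by simp))]; simp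
        generalize (search d k).run (t.set 11 i) = t₂ at *
        rw [e] at hreach hfreeable
        -- The invariants of exchanges that matter here: properness, the set of uncolored vertices,
        -- the bound `k`, and the colors at large degree.
        obtain ⟨k1, k2, k3, k4⟩ := hreach (fun c => Kempe.PartialProper G c ∧
          (∀ x, c x = 0 ↔ colors n t x = 0) ∧ ((∀ x, colors n t x ≤ k) → ∀ x, c x ≤ k) ∧
          ∀ x, d ≤ G.degree x → c x = colors n t x)
          (by
            rintro c u b hb hbk ⟨h1, h2, h3, h4⟩
            exact ⟨h1.swap (by omega), fun x => (Kempe.swap_eq_zero (by omega) x).trans (h2 x),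
              fun hk => Kempe.swap_le hbk (h3 hk),
              fun x hx => (Kempe.swap_of_le_degree hx).trans (h4 x hx)⟩)
          ⟨hI1, fun _ => Iff.rfl, fun h => h, fun _ _ => rfl⟩
        obtain ⟨f, hf, hcol⟩ := hrd₂.color_spec (v := ⟨i, hi⟩) h11
        have hc₂ : colors n t₂ ⟨i, hi⟩ = 0 := (k2 _).2 hc
        rw [hcol]
        refine ⟨k1.update hc₂ hf.free, fun x hx => ?_, fun hsol => ?_⟩
        · by_cases hxi : x = ⟨i, hi⟩
          · have := hf.one_le
            rw [hxi, Function.update_self]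
            omega
          · rw [Function.update_of_ne hxi, ne_eq, k2]
            refine hI2 x (lt_of_le_of_ne (Nat.lt_succ_iff.1 hx) fun h => hxi (Fin.ext h))
        · obtain ⟨hle, hfix⟩ := hI3 hsol
          have hfk : f ≤ k := hf.hasFree_iff.1 (hfree (hfreeable
            ((hsol p hp hd).2 _ hI1 hle hfix _ hc)))
          constructor
          · intro x
            by_cases hxi : x = ⟨i, hi⟩
            · rwa [hxi, Function.update_self]
            · rw [Function.update_of_ne hxi]
              exact k3 hle x
          · intro x hx
            have hxi : x ≠ ⟨i, hi⟩ := by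
              rintro rfl
              exact hd _ hx ((hfix _ hx).symm.trans hc)
            rw [Function.update_of_ne hxi, k4 x hx, hfix x hx]
      · rw [if_neg hc, Cmd.run_skip, e]
        refine ⟨hI1, fun x hx => ?_, hI3⟩
        rcases Nat.lt_succ_iff_lt_or_eq.1 hx with hlt | rfl
        · exact hI2 x hlt
        · exact hc)
  rw [extend, hrun]
  have e : colors n (t.set 11 (rounds s none)) = colors n t := rfl
  rw [e]
  exact ⟨hI.1, fun x => hI.2.1 x (by rw [rounds, h.size]; exact x.2), fun hsol => (hI.2.2 hsol).1⟩

/-- Look for a coloring with `k` colors, the vertices of degree at least `d` being colored first,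
and copy it to array `1` if successful. -/
def attempt (d k : ℕ) : Cmd :=
  fill 6 4 (.const 1) (.const 0) ;;
  precolor d ;;
  extend d k ;;
  .assign 9 (.const 1) ;;
  flag 6 9 0 (.minus (.read 4 (.var 6)) (.const k)) ;;
  .cond (.var 9) (copy 1 4) .skip

/-- Array `1` holds a proper coloring with the colors `1, …, k`. -/
def HasOutput (G : SimpleGraph (Fin n)) (k : ℕ) (s : State) : Prop :=
  (∀ x y : Fin n, G.Adj x y → s.arr 1 x ≠ s.arr 1 y) ∧ ∀ x : Fin n, 1 ≤ s.arr 1 x ∧ s.arr 1 x ≤ k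

/-- The output array is overwritten only if a check shows that at most the color `k` occurs. So a
failure cannot spoil an earlier output. -/
theorem Ready.attempt_spec {s : State} (h : Ready G s) (d k : ℕ) :
    Ready G ((attempt d k).run s) ∧
    (((attempt d k).run s).arr 1 = s.arr 1 ∨ HasOutput G k ((attempt d k).run s)) ∧
    (Kempe.Solvable G d k → HasOutput G k ((attempt d k).run s)) := by
  classical
  have h₁ : Ready G ((fill 6 4 (.const 1) (.const 0)).run s) := h.run rfl rfl rfl rfl
  have hclear : ∀ x, colors n ((fill 6 4 (.const 1) (.const 0)).run s) x = 0 :=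
    h.run_fill (by decide) (by decide) (fun _ => 0) (by intros; simp)
  have out₁ : ((fill 6 4 (.const 1) (.const 0)).run s).arr 1 = s.arr 1 := Cmd.run_arr rfl s
  rw [attempt, Cmd.run_seq, Cmd.run_seq, Cmd.run_seq, Cmd.run_seq, Cmd.run_seq]
  generalize (fill 6 4 (.const 1) (.const 0)).run s = s₁ at *
  obtain ⟨hp, hpd⟩ := h₁.precolor_spec d hclear
  have h₂ : Ready G ((precolor d).run s₁) := h₁.run rfl rfl rfl rfl
  have out₂ : ((precolor d).run s₁).arr 1 = s.arr 1 := (Cmd.run_arr rfl s₁).trans out₁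
  generalize (precolor d).run s₁ = s₂ at *
  obtain ⟨hproper, hall, hsol⟩ := h₂.extend_spec d k hp hpd
  obtain ⟨hz, hz0⟩ := extend_writes d k
  have h₃ : Ready G ((extend d k).run s₂) :=
    h₂.run hz0 (hz 0 (by simp)) (hz 2 (by simp)) (hz 3 (by simp))
  have out₃ : ((extend d k).run s₂).arr 1 = s.arr 1 :=
    (Cmd.run_arr (hz 1 (by simp)) s₂).trans out₂
  generalize (extend d k).run s₂ = s₃ at *
  rw [Cmd.run_assign, eval_const]
  have h₄ : Ready G (s₃.set 9 1) := h₃.of_eq (by simp) rfl rfl rfl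
  have hflag := h₄.run_flag (r := 6) (q := 9) (w := 0) (e := .minus (.read 4 (.var 6)) (.const k))
    (by decide) (by decide) (by decide) (fun x => k < colors n s₃ x) (by
      intro x t _ _ harr h6
      simp only [eval_minus, eval_read, eval_var, eval_const, h6, harr, State.set_arr, colors]
      omega)
  have h₅ : Ready G ((flag 6 9 0 (.minus (.read 4 (.var 6)) (.const k))).run (s₃.set 9 1)) :=
    h₄.run rfl rfl rfl rfl
  have harr₅ : ((flag 6 9 0 (.minus (.read 4 (.var 6)) (.const k))).run (s₃.set 9 1)).arr =
      s₃.arr := funext fun a => Cmd.run_arr rfl _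
  generalize (flag 6 9 0 (.minus (.read 4 (.var 6)) (.const k))).run (s₃.set 9 1) = s₅ at *
  rw [Cmd.run_cond, eval_var, hflag]
  by_cases hex : ∃ x, k < colors n s₃ x
  · rw [if_pos hex, if_pos rfl, Cmd.run_skip]
    refine ⟨h₅, .inl (by rw [harr₅, out₃]), fun hs => ?_⟩
    obtain ⟨x, hx⟩ := hex
    exact absurd (hsol hs x) (by omega)
  · rw [if_neg hex, if_neg (by simp)]
    push Not at hex
    have hout : HasOutput G k ((copy 1 4).run s₅) := by
      have hcopy : ∀ x : Fin n, ((copy 1 4).run s₅).arr 1 x = colors n s₃ x := fun x => by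
        rw [h₅.copy_spec (by decide) (by decide), harr₅]; rfl
      refine ⟨fun x y hxy => ?_, fun x => ?_⟩
      · rw [hcopy, hcopy]
        exact hproper x y hxy (hall x)
      · rw [hcopy]
        exact ⟨Nat.one_le_iff_ne_zero.2 (hall x), hex x⟩
    exact ⟨h₅.run rfl rfl rfl rfl, .inr hout, fun _ => hout⟩

end RAM

/-! ### Sufficient conditions for solvability -/

namespace Kempe

variable {n : ℕ} {G : SimpleGraph (Fin n)} [DecidableRel G.Adj]

theorem hasFree_of_degree_lt {k : ℕ} {v : Fin n} (h : G.degree v < k) (c : Fin n → ℕ) :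
    HasFree G k v c := by
  classical
  have hlt : ((G.neighborFinset v).image c).card < (Finset.Icc 1 k).card := by
    have := Finset.card_image_le (s := G.neighborFinset v) (f := c)
    rw [G.card_neighborFinset_eq_degree] at this
    rw [Nat.card_Icc]
    omega
  obtain ⟨f, hf, hfc⟩ := Finset.exists_mem_notMem_of_card_lt_card hlt
  rw [Finset.mem_Icc] at hf
  exact ⟨f, hf.1, hf.2, fun y hy hyf => hfc (Finset.mem_image.2 ⟨y, by simpa, hyf⟩)⟩

/-- If the vertices of degree at least `d` are colored with `k` colors and the others have degree
less than `k`, then greedy coloring succeeds. -/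
theorem solvable_of_degree_lt {d k : ℕ} (hdeg : ∀ x, d ≤ G.degree x ∨ G.degree x < k)
    (hle : ∀ p, Precoloring G d p → ∀ x, p x ≤ k) : Solvable G d k := by
  intro p hp hpd
  refine ⟨hle p hp, fun c _ _ hc v hv => .of_hasFree (hasFree_of_degree_lt ?_ c)⟩
  refine (hdeg v).resolve_left fun hd => hpd v hd ?_
  rw [← hc v hd, hv]

theorem solvable_of_stable {d k : ℕ} (hk : 1 ≤ k)
    (hst : ∀ x y, G.Adj x y → d ≤ G.degree x → ¬ d ≤ G.degree y)
    (hdeg : ∀ x, d ≤ G.degree x ∨ G.degree x < k) : Solvable G d k :=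
  solvable_of_degree_lt hdeg fun _ hp x => (hp.one hst x).trans hk

theorem solvable_of_bicoloring {d k : ℕ} (hk : 2 ≤ k) (hbi : ∃ f, Bicoloring G d f)
    (hdeg : ∀ x, d ≤ G.degree x ∨ G.degree x < k) : Solvable G d k := by
  refine solvable_of_degree_lt hdeg fun p hp x => ?_
  obtain ⟨f, hf⟩ := hbi
  obtain ⟨g, _, hg⟩ := hp.two f hf
  by_cases hx : p x = 0
  · omega
  · have := hg x hx
    split_ifs at this <;> omega

/-- A version of Brooks' theorem for graphs without cliques of size four, in which the vertices of
degree at least `d` are pairwise not adjacent and the others have degree at most `k`. -/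
theorem solvable_of_cliqueFree {d k : ℕ} (hk : 3 ≤ k) (hG : G.CliqueFree 4)
    (hst : ∀ x y, G.Adj x y → d ≤ G.degree x → ¬ d ≤ G.degree y)
    (hdeg : ∀ x, d ≤ G.degree x ∨ G.degree x ≤ k) (hd : 4 ≤ k ∨ ∀ x, G.degree x < d) :
    Solvable G d k := by
  intro p hp hpd
  have hp1 := hp.one hst
  refine ⟨fun x => (hp1 x).trans (by omega), fun c hc _ hcp v hv => ?_⟩
  have hv' : G.degree v ≤ k := (hdeg v).resolve_left fun hd => hpd v hd (by rw [← hcp v hd, hv])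
  -- The precoloring uses only color `1`. If `k ≥ 4`, the last three colors avoid it; if `k = 3`, no
  -- vertex is precolored.
  refine Config.freeable_of_cliqueFree (i := k - 2) (j := k - 1) (l := k)
    ⟨hc, hv, hv', by omega, by omega, by omega, fun x hx => ?_⟩ hG
  have hlow : ¬ d ≤ G.degree x := by
    intro hdx
    have h1 := hcp x hdx
    have h2 := hp1 x
    rcases hd with hd | hd
    · omega
    · have := hd x
      omega
  exact ⟨(hdeg x).resolve_left hlow, by omega⟩

end Kempe

/-! ### The complete algorithm -/

namespace RAM

/-- Compute the positions of the rows of the adjacency matrix. -/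
def rowStarts : Cmd :=
  .assign 5 (.const 0) ;;
  .iter 6 none (.store 2 (.var 6) (.var 5) ;; .assign 5 (.plus (.var 5) (.var 0)))

/-- Compute the degrees. -/
def degrees : Cmd :=
  .iter 6 none (.iter 7 none (.cond (adjE 6 7)
    (.store 3 (.var 6) (.plus (.read 3 (.var 6)) (.const 1))) .skip))

/-- A sequence of attempts. -/
def attempts : List (ℕ × ℕ) → Cmd
  | [] => .skip
  | (d, k) :: l => attempt d k ;; attempts l

/-- The coloring algorithm. -/
def coloring : Cmd :=
  rowStarts ;; degrees ;; attempts [(5, 5), (4, 4), (5, 4), (5, 3), (5, 2), (5, 1)]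

/-- The machine cannot multiply, so the offsets `i * n` are accumulated by repeated addition of
register `0`. -/
theorem rowStarts_spec (s : State) (i : ℕ) (hi : i < s.reg 0) :
    (rowStarts.run s).arr 2 i = i * s.reg 0 := by
  rw [rowStarts, Cmd.run_seq, Cmd.run_assign, eval_const]
  obtain ⟨t, hI, hrun, -, -⟩ := Cmd.run_iter (r := 6) (b := none)
    (c := .store 2 (.var 6) (.var 5) ;; .assign 5 (.plus (.var 5) (.var 0)))
    (fun i t => t.reg 5 = i * s.reg 0 ∧ ∀ j < i, t.arr 2 j = j * s.reg 0) (s.set 5 0)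
    (by simp)
    (by
      rintro i t hi hreg harr ⟨h5, hI⟩
      have h0 : t.reg 0 = s.reg 0 := by simpa using hreg 0 (by decide) rfl
      constructor
      · simp [h5, h0, Nat.succ_mul]
      · intro j hj
        by_cases hji : j = i
        · simp [hji, h5]
        · simpa [hji] using hI j (by omega))
  rw [hrun]
  exact hI.2 i (by simpa [rounds] using hi)

variable {n : ℕ} {G : SimpleGraph (Fin n)}

theorem graphInput_arr (i j : Fin n) [Decidable (G.Adj i j)] :
    (graphInput G).arr 0 (i * n + j) = if G.Adj i j then 1 else 0 := by
  have hn : 0 < n := i.pos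
  have hdiv : ∀ a b : Fin n, ((a : ℕ) * n + b) / n = a := fun a b => by
    rw [Nat.add_comm, Nat.add_mul_div_right _ _ hn, Nat.div_eq_of_lt b.2, Nat.zero_add]
  have hiff : (∃ i' j' : Fin n, (i : ℕ) * n + j = i' * n + j' ∧ G.Adj i' j') ↔ G.Adj i j := by
    constructor
    · rintro ⟨i', j', he, ha⟩
      have hi : i = i' := Fin.ext (by rw [← hdiv i j, he, hdiv])
      subst hi
      have hj : j = j' := Fin.ext (by omega)
      rwa [hj]
    · exact fun ha => ⟨i, j, rfl, ha⟩
  simp only [graphInput, true_and, hiff]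

variable [DecidableRel G.Adj]

theorem degrees_spec {s : State} (h0 : s.reg 0 = n)
    (hadj : ∀ i j : Fin n, s.arr 0 (s.arr 2 i + j) = if G.Adj i j then 1 else 0)
    (hz : ∀ i, s.arr 3 i = 0) : Ready G (degrees.run s) := by
  refine ⟨(Cmd.run_reg rfl s).trans h0, ?_, ?_⟩
  · rw [Cmd.run_arr (c := degrees) rfl s, Cmd.run_arr (c := degrees) rfl s]
    exact hadj
  obtain ⟨t, hI, hrun, -, -⟩ := Cmd.run_iter (r := 6) (b := none)
    (c := .iter 7 none (.cond (adjE 6 7)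
      (.store 3 (.var 6) (.plus (.read 3 (.var 6)) (.const 1))) .skip))
    (fun i t => ∀ x : Fin n, t.arr 3 x = if (x : ℕ) < i then G.degree x else 0) s
    (by simp [hz])
    (by
      intro i t hi hreg harr hI
      have hi : i < n := by simpa [rounds, h0] using hi
      have h0t : t.reg 0 = n := (hreg 0 (by decide) rfl).trans h0
      obtain ⟨t', hI', hrun', -, -⟩ := Cmd.run_iter (r := 7) (b := none)
        (c := .cond (adjE 6 7) (.store 3 (.var 6) (.plus (.read 3 (.var 6)) (.const 1))) .skip)
        (fun j t' => t'.arr 3 i =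
            (Finset.univ.filter fun y : Fin n => (y : ℕ) < j ∧ G.Adj ⟨i, hi⟩ y).card ∧
          ∀ x : Fin n, (x : ℕ) ≠ i → t'.arr 3 x = t.arr 3 x) (t.set 6 i)
        (by simpa using hI ⟨i, hi⟩)
        (by
          rintro j p hj hregp harrp ⟨hJ, hJ'⟩
          have hj : j < n := by simpa [rounds, h0t] using hj
          have h6 : p.reg 6 = i := by rw [hregp 6 (by decide) rfl]; simp
          have ha : (adjE 6 7).eval (p.set 7 j) = if G.Adj ⟨i, hi⟩ ⟨j, hj⟩ then 1 else 0 := by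
            have := hadj ⟨i, hi⟩ ⟨j, hj⟩
            rw [← this]
            simp only [adjE, eval_read, eval_plus, eval_var, State.set_reg, State.set_arr, if_true,
              if_neg (show (6 : ℕ) ≠ 7 by decide), h6]
            rw [harrp 0 rfl, harrp 2 rfl, State.set_arr, harr 0 rfl, harr 2 rfl]
          rw [Cmd.run_cond, ha]
          by_cases hij : G.Adj ⟨i, hi⟩ ⟨j, hj⟩
          · rw [if_pos hij, if_neg one_ne_zero, Cmd.run_store]
            have hins : (Finset.univ.filter fun y : Fin n => (y : ℕ) < j + 1 ∧ G.Adj ⟨i, hi⟩ y) =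
                insert ⟨j, hj⟩
                  (Finset.univ.filter fun y : Fin n => (y : ℕ) < j ∧ G.Adj ⟨i, hi⟩ y) := by
              ext y
              simp only [Finset.mem_filter, Finset.mem_univ, true_and, Finset.mem_insert]
              constructor
              · rintro ⟨h1, h2⟩
                rcases Nat.lt_succ_iff_lt_or_eq.1 h1 with h | h
                · exact .inr ⟨h, h2⟩
                · exact .inl (Fin.ext h)
              · rintro (rfl | ⟨h1, h2⟩)
                · exact ⟨Nat.lt_succ_self _, hij⟩
                · exact ⟨by omega, h2⟩
            constructor
            · rw [hins, Finset.card_insert_of_notMem (by simp), ← hJ]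
              simp [h6]
            · intro x hx
              simp only [State.put_arr, State.set_arr, eval_var, State.set_reg,
                if_neg (show (6 : ℕ) ≠ 7 by decide), h6, hx, and_false, if_false]
              exact hJ' x hx
          · rw [if_neg hij, if_pos rfl, Cmd.run_skip]
            refine ⟨hJ.trans (congrArg Finset.card (Finset.filter_congr fun y _ => ?_)), hJ'⟩
            refine and_congr_left fun hy => ?_
            have : (y : ℕ) ≠ j := by rintro rfl; exact hij hy
            omega)
      rw [hrun']
      intro x
      rw [State.set_arr]
      by_cases hx : (x : ℕ) = i
      · have hxi : x = ⟨i, hi⟩ := Fin.ext hx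
        have hr : rounds (t.set 6 i) none = n := by simpa [rounds] using h0t
        rw [hx, if_pos (by omega), hI'.1, hr, ← G.card_neighborFinset_eq_degree, hxi]
        congr 1
        ext y
        simp
      · rw [hI'.2 x hx, hI x]
        congr 1
        exact propext (by omega))
  intro x
  rw [degrees, hrun, State.set_arr, hI x, if_pos]
  rw [rounds, h0]
  exact x.2

theorem setup_spec : Ready G (degrees.run (rowStarts.run (graphInput G))) := by
  refine degrees_spec ((Cmd.run_reg rfl _).trans rfl) (fun i j => ?_) (fun i => ?_)
  · rw [rowStarts_spec _ _ i.2, Cmd.run_arr rfl]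
    exact graphInput_arr i j
  · rw [Cmd.run_arr rfl]
    simp [graphInput]

/-- Since `k` never increases along the list, a later success only lowers the number of colors, and
a later failure keeps the output. So every solvable pair in the list guarantees its bound at the
end. -/
theorem Ready.attempts_spec (l : List (ℕ × ℕ)) {s : State} (h : Ready G s) :
    (∀ K, (∀ q ∈ l, q.2 ≤ K) → HasOutput G K s → HasOutput G K ((attempts l).run s)) ∧
    (l.Pairwise (fun q q' => q'.2 ≤ q.2) → ∀ q ∈ l, Kempe.Solvable G q.1 q.2 →
      HasOutput G q.2 ((attempts l).run s)) := by
  induction l generalizing s with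
  | nil => exact ⟨fun _ _ h => h, by simp⟩
  | cons q l ih =>
    obtain ⟨d, k⟩ := q
    obtain ⟨h', hout, hsol⟩ := h.attempt_spec d k
    obtain ⟨ih₁, ih₂⟩ := ih h'
    rw [attempts, Cmd.run_seq]
    refine ⟨fun K hK hs => ih₁ K (fun q hq => hK q (by simp [hq])) ?_, fun hl q hq hs => ?_⟩
    · rcases hout with ho | ho
      · unfold HasOutput
        rw [ho]
        exact hs
      · exact ⟨ho.1, fun x => ⟨(ho.2 x).1, (ho.2 x).2.trans (hK (d, k) (by simp))⟩⟩
    · rw [List.pairwise_cons] at hl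
      rcases List.mem_cons.1 hq with rfl | hq
      · exact ih₁ k hl.1 (hsol hs)
      · exact ih₂ hl.2 q hq hs

/-- `wf` and `writesReg` take values in `Bool`, and the program is a closed term, so evaluation
decides this. -/
theorem coloring_wf : coloring.wf = true := by
  rfl

theorem coloring_spec {d k : ℕ}
    (hmem : (d, k) ∈ [(5, 5), (4, 4), (5, 4), (5, 3), (5, 2), (5, 1)])
    (hs : Kempe.Solvable G d k) : HasOutput G k (coloring.run (graphInput G)) := by
  rw [coloring, Cmd.run_seq, Cmd.run_seq]
  exact (setup_spec.attempts_spec _).2 (by decide) _ hmem hs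

end RAM

/-! ### Choice of the pair and comparison with the bound -/

/-- Under either hypothesis of the theorem one of the attempts succeeds, with few enough colors. -/
theorem exists_solvable {n : ℕ} {G : SimpleGraph (Fin n)} [DecidableRel G.Adj]
    (h : HighDegreeStable G ∨ OddCyclesHaveLowDegree G) :
    ∃ d k, (d, k) ∈ [(5, 5), (4, 4), (5, 4), (5, 3), (5, 2), (5, 1)] ∧
      Kempe.Solvable G d k ∧ 2 * k ≤ G.maxDegree + G.cliqueNum + 2 := by
  have hdeg := G.degree_le_maxDegree
  have hclique : ∀ {m : ℕ}, ¬ G.CliqueFree m → m ≤ G.cliqueNum := by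
    intro m hm
    simp only [SimpleGraph.CliqueFree, not_forall, not_not] at hm
    obtain ⟨t, ht⟩ := hm
    rw [← ht.card_eq]
    exact ht.isClique.card_le_cliqueNum
  have htwo : 1 ≤ G.maxDegree → 2 ≤ G.cliqueNum := by
    intro h1
    refine hclique fun hcf => ?_
    rw [SimpleGraph.cliqueFree_two] at hcf
    have := G.maxDegree_le_of_forall_degree_le 0 fun x => by
      rw [← G.card_neighborFinset_eq_degree, Nat.le_zero, Finset.card_eq_zero]
      ext y
      simp [hcf]
    omega
  by_cases hst : ∀ x y, G.Adj x y → 5 ≤ G.degree x → ¬ 5 ≤ G.degree y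
  · have low : ∀ x, 5 ≤ G.degree x ∨ G.degree x < 5 := fun x => le_or_gt _ _
    by_cases hfree : G.CliqueFree 4
    · by_cases h3 : G.maxDegree ≤ 3
      · have hlt : ∀ x, G.degree x < 5 := fun x => by have := hdeg x; omega
        -- For `Δ ≤ 1` greedy coloring with `Δ + 1` colors is good enough. For `Δ` equal to 2 or 3,
        -- `ω ≥ 2` allows three colors, and nothing is precolored.
        rcases (by omega : G.maxDegree = 0 ∨ G.maxDegree = 1 ∨ 2 ≤ G.maxDegree) with hD | hD | hD
        · exact ⟨5, 1, by simp, Kempe.solvable_of_stable le_rfl hst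
            (fun x => .inr (by have := hdeg x; omega)), by omega⟩
        · exact ⟨5, 2, by simp, Kempe.solvable_of_stable (by decide) hst
            (fun x => .inr (by have := hdeg x; omega)), by omega⟩
        · exact ⟨5, 3, by simp, Kempe.solvable_of_cliqueFree le_rfl hfree hst
            (fun x => .inr ((hdeg x).trans h3)) (.inr hlt), by omega⟩
      · exact ⟨5, 4, by simp, Kempe.solvable_of_cliqueFree (by decide) hfree hst
          (fun x => (low x).imp_right Nat.lt_succ_iff.1) (.inl le_rfl), by omega⟩
    · have h4 := hclique hfree
      by_cases hD : G.maxDegree ≤ 3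
      · refine ⟨5, 4, by simp, Kempe.solvable_of_stable (by decide) hst
          (fun x => .inr (by have := hdeg x; omega)), ?_⟩
        -- Four colors need `Δ + ω ≥ 6` here; a 4-clique gives `ω ≥ 4` and a vertex of degree at
        -- least `3`.
        obtain ⟨t, ht⟩ : ∃ t, G.IsNClique 4 t := by
          simpa [SimpleGraph.CliqueFree] using hfree
        obtain ⟨x, hx⟩ : t.Nonempty := Finset.card_pos.1 (by rw [ht.card_eq]; decide)
        have hsub : t.erase x ⊆ G.neighborFinset x := by
          intro y hy
          rw [Finset.mem_erase] at hy
          simpa using ht.isClique hx hy.2 hy.1.symm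
        have h5 := Finset.card_le_card hsub
        rw [Finset.card_erase_of_mem hx, ht.card_eq, G.card_neighborFinset_eq_degree] at h5
        have := hdeg x
        omega
      · exact ⟨5, 5, by simp, Kempe.solvable_of_stable (by decide) hst low, by omega⟩
  -- Two adjacent vertices of degree at least `5` rule out the first hypothesis and give `Δ + ω ≥
  -- 7`, so four colors are allowed.
  · have hodd : OddCyclesHaveLowDegree G := h.resolve_left fun hs =>
      hst fun x y hxy hx hy => hs hx hy hxy.ne hxy
    push Not at hst
    obtain ⟨x, _, _, hx, _⟩ := hst
    have := hdeg x
    exact ⟨4, 4, by simp, Kempe.solvable_of_bicoloring (by decide) hodd.exists_bicoloring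
      (fun x => le_or_gt _ _), by omega⟩

theorem theorem5 :
    ∃ (prog : RAM.Prog) (p : Polynomial ℕ),
      ∀ (n : ℕ) (G : SimpleGraph (Fin n)) [DecidableRel G.Adj],
        HighDegreeStable G ∨ OddCyclesHaveLowDegree G →
          ∃ (t : ℕ) (s : RAM.State),
            RAM.Exec prog (RAM.graphInput G) t s ∧ t ≤ p.eval n ∧
              ∃ C : G.Coloring ℕ, (∀ v : Fin n, C v = s.arr 1 v) ∧ ObeysReed G C := by
  refine ⟨RAM.coloring.compile, RAM.coloring.time, fun n G _ h => ?_⟩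
  obtain ⟨t, ht, hexec⟩ := RAM.Cmd.exec_compile RAM.coloring_wf (RAM.graphInput G)
  obtain ⟨d, k, hmem, hsol, hk⟩ := exists_solvable h
  have hout := RAM.coloring_spec hmem hsol
  rw [show (RAM.graphInput G).reg 0 = n from rfl] at ht
  generalize RAM.coloring.run (RAM.graphInput G) = s at hexec hout
  obtain ⟨hproper, hle⟩ := hout
  refine ⟨t, s, hexec, ht, SimpleGraph.Coloring.mk (fun v => s.arr 1 v)
    fun {x y} hxy => hproper x y hxy, fun v => rfl, ?_⟩
  have hcard : (Finset.univ.image fun v : Fin n => s.arr 1 v).card ≤ k := by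
    refine (Finset.card_le_card (t := Finset.Icc 1 k) fun c hc => ?_).trans (by simp)
    obtain ⟨v, _, rfl⟩ := Finset.mem_image.1 hc
    exact Finset.mem_Icc.2 (hle v)
  refine hcard.trans ?_
  rcases Nat.eq_zero_or_pos k with rfl | hpos
  · exact Nat.zero_le _
  -- For integers, `k ≤ ⌈q⌉` means `k - 1 < q`, which absorbs the rounding in `2k ≤ Δ + ω + 2`.
  · have hlt : k - 1 < ⌈((G.maxDegree : ℚ) + (G.cliqueNum : ℚ) + 1) / 2⌉₊ := by
      rw [Nat.lt_ceil, Nat.cast_sub hpos, lt_div_iff₀ (by norm_num)]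
      have : (2 * k : ℚ) ≤ G.maxDegree + G.cliqueNum + 2 := by exact_mod_cast hk
      push_cast
      linarith
    omega
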